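/- Let $\theta\in[0,2\pi)$ with $\theta\neq 0,\pi$, and put $c=\cos\theta$, $s=\sin\theta$. Consider the 3-state quantum walk on $\mathbb{Z}$ with amplitudes $\psi_t(x)\in\mathbb{C}^3$ ($t=0,1,2,\dots$, $x\in\mathbb{Z}$) and coin $$C=\begin{pmatrix}-\frac{1+c}{2}&\frac{s}{\sqrt2}&\frac{1-c}{2}\\ \frac{s}{\sqrt2}&c&\frac{s}{\sqrt2}\\ \frac{1-c}{2}&\frac{s}{\sqrt2}&-\frac{1+c}{2}\end{pmatrix},$$ where one step applies $C$ at every position and then moves coin component $0$ from $x$ to $x-1$, keeps component $1$ at $x$, and moves component $2$ from $x$ to $x+1$. The initial state is $\psi_0(0)=(\alpha,\beta,\gamma)$ and $\psi_0(x)=0$ for $x\ne0$, where $\alpha,\beta,\gamma\in\mathbb{C}$ and $|\alpha|^2+|\beta|^2+|\gamma|^2=1$. Let $X_t$ be the position at time $t$: $\mathbb{P}(X_t=x)=\|\psi_t(x)\|^2$. Put $$\nu=\frac{-(3-c)+2\sqrt{2(1-c)}}{1+c},\quad A=2(1-c)\alpha+\sqrt2\,s\beta,\quad B=\sqrt2\,s\beta+2(1-c)\gamma,$$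 $$\Delta=\frac{1}{8\sqrt2(1-c)^{3/2}}\left\{|A|^2+|B|^2+2\nu\,\Re(A\overline B)\right\},\qquad f(x)=\frac{\sqrt{1-c}\,(d_0+d_1x+d_2x^2)}{2\pi(1-x^2)\sqrt{1+c-2x^2}},$$ $$d_0=|\alpha+\gamma|^2+2|\beta|^2,$$ $$d_1=2\left\{-|\alpha-\beta|^2+|\gamma-\beta|^2-\left(2-\frac{\sqrt2 s}{1+c}\right)\Re\left((\alpha-\gamma)\overline\beta\right)\right\},$$ $$d_2=|\alpha|^2-2|\beta|^2+|\gamma|^2-2\left\{\frac{\sqrt2 s}{1+c}\Re\left((\alpha+\gamma)\overline\beta\right)+\frac{3-c}{1+c}\Re(\alpha\overline\gamma)\right\},$$ and $J=\left(-\sqrt{\frac{1+c}{2}},\sqrt{\frac{1+c}{2}}\right)$. Then $\Delta\ge0$, $f$ is non-negative and integrable on $J$, $\Delta\delta_0+f(x)\mathbf 1_J(x)\,dx$ is a probability measure on $\mathbb{R}$, and $X_t/t$ converges in distribution to it as $t\to\infty$. In particular, for every real $x\neq0$ (and also for $x=0$ if $\Delta=0$), $$\lim_{t\to\infty}\mathbb{P}\left(\frac{X_t}{t}\le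 x\right)=\Delta\,\mathbf 1_{[0,\infty)}(x)+\int_{-\infty}^x f(y)\mathbf 1_J(y)\,dy .$$ Moreover $\Delta$ is the total mass of the limit measure of the unscaled walk: for every $x\in\mathbb{Z}$, $$\lim_{t\to\infty}\mathbb{P}(X_t=x)=m(x):=\frac{1}{64(1-c)^2}\Big\{2(1-c)\left|B\nu^{|x+1|}+A\nu^{|x|}\right|^2+(1+c)\left|B\nu^{|x+1|}+(A+B)\nu^{|x|}+A\nu^{|x-1|}\right|^2+2(1-c)\left|B\nu^{|x|}+A\nu^{|x-1|}\right|^2\Big\},$$ and $\sum_{x\in\mathbb{Z}}m(x)=\Delta$. -/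

import Mathlib

open Filter Topology MeasureTheory Set

namespace ThreeStateWalk

noncomputable section

/-- The coin operator with parameter `θ`, where `c = cos θ` and `s = sin θ`. -/
def coin (θ : ℝ) : Matrix (Fin 3) (Fin 3) ℂ :=
  let c : ℝ := Real.cos θ
  let s : ℝ := Real.sin θ
  !![((-(1 + c) / 2 : ℝ) : ℂ), ((s / √2 : ℝ) : ℂ), (((1 - c) / 2 : ℝ) : ℂ);
     ((s / √2 : ℝ) : ℂ), ((c : ℝ) : ℂ), ((s / √2 : ℝ) : ℂ);
     (((1 - c) / 2 : ℝ) : ℂ), ((s / √2 : ℝ) : ℂ), ((-(1 + c) / 2 : ℝ) : ℂ)]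

/-- The position shift: coin state `0` moves from `x` to `x - 1`, coin state `1` stays,
coin state `2` moves from `x` to `x + 1`. -/
def shift (ψ : ℤ → Fin 3 → ℂ) : ℤ → Fin 3 → ℂ :=
  fun x => ![ψ (x + 1) 0, ψ x 1, ψ (x - 1) 2]

/-- One step of the walk: the coin is applied at every position, then the shift. -/
def step (θ : ℝ) (ψ : ℤ → Fin 3 → ℂ) : ℤ → Fin 3 → ℂ :=
  shift fun x => (coin θ).mulVec (ψ x)

/-- The initial state `|0⟩ ⊗ (α|0⟩ + β|1⟩ + γ|2⟩)`, concentrated at the origin. -/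
def initial (α β γ : ℂ) : ℤ → Fin 3 → ℂ :=
  fun x => if x = 0 then ![α, β, γ] else 0

/-- The amplitudes of the walk at time `t`, for the walk started at the origin. -/
def amplitude (θ : ℝ) (α β γ : ℂ) (t : ℕ) : ℤ → Fin 3 → ℂ :=
  (step θ)^[t] (initial α β γ)

/-- The probability `ℙ(X_t = x)`. -/
def prob (θ : ℝ) (α β γ : ℂ) (t : ℕ) (x : ℤ) : ℝ :=
  ∑ j : Fin 3, ‖amplitude θ α β γ t x j‖ ^ 2

/-- The law of the position `X_t`, a measure on `ℤ`. -/
def law (θ : ℝ) (α β γ : ℂ) (t : ℕ) : Measure ℤ :=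
  Measure.sum fun x : ℤ => ENNReal.ofReal (prob θ α β γ t x) • Measure.dirac x

/-- `ν = (-(3 - c) + 2 √(2 (1 - c))) / (1 + c)`. -/
def nu (θ : ℝ) : ℝ :=
  (-(3 - Real.cos θ) + 2 * √(2 * (1 - Real.cos θ))) / (1 + Real.cos θ)

/-- `A = 2 (1 - c) α + √2 s β`. -/
def coeffA (θ : ℝ) (α β : ℂ) : ℂ :=
  ((2 * (1 - Real.cos θ) : ℝ) : ℂ) * α + ((√2 * Real.sin θ : ℝ) : ℂ) * β

/-- `B = √2 s β + 2 (1 - c) γ`. -/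
def coeffB (θ : ℝ) (β γ : ℂ) : ℂ :=
  ((√2 * Real.sin θ : ℝ) : ℂ) * β + ((2 * (1 - Real.cos θ) : ℝ) : ℂ) * γ

/-- The mass at the position `x` of the long-time limit measure of the (unscaled) walk. -/
def limitMass (θ : ℝ) (α β γ : ℂ) (x : ℤ) : ℝ :=
  let c : ℝ := Real.cos θ
  let A : ℂ := coeffA θ α β
  let B : ℂ := coeffB θ β γ
  let p : ℤ → ℂ := fun y => ((nu θ ^ y.natAbs : ℝ) : ℂ)
  1 / (64 * (1 - c) ^ 2) *
    (2 * (1 - c) * ‖B * p (x + 1) + A * p x‖ ^ 2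
      + (1 + c) * ‖B * p (x + 1) + (A + B) * p x + A * p (x - 1)‖ ^ 2
      + 2 * (1 - c) * ‖B * p x + A * p (x - 1)‖ ^ 2)

/-- The weight `Δ` of the atom at the origin. -/
def Delta (θ : ℝ) (α β γ : ℂ) : ℝ :=
  let A : ℂ := coeffA θ α β
  let B : ℂ := coeffB θ β γ
  1 / (8 * √2 * (1 - Real.cos θ) ^ (3 / 2 : ℝ)) *
    (‖A‖ ^ 2 + ‖B‖ ^ 2 + 2 * nu θ * (A * star B).re)

def d0 (α β γ : ℂ) : ℝ := ‖α + γ‖ ^ 2 + 2 * ‖β‖ ^ 2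

def d1 (θ : ℝ) (α β γ : ℂ) : ℝ :=
  2 * (-‖α - β‖ ^ 2 + ‖γ - β‖ ^ 2
    - (2 - √2 * Real.sin θ / (1 + Real.cos θ)) * ((α - γ) * star β).re)

def d2 (θ : ℝ) (α β γ : ℂ) : ℝ :=
  ‖α‖ ^ 2 - 2 * ‖β‖ ^ 2 + ‖γ‖ ^ 2
    - 2 * (√2 * Real.sin θ / (1 + Real.cos θ) * ((α + γ) * star β).re
      + (3 - Real.cos θ) / (1 + Real.cos θ) * (α * star γ).re)

/-- The function `f`, meaningful on the open interval `window θ`. -/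
def density (θ : ℝ) (α β γ : ℂ) (x : ℝ) : ℝ :=
  √(1 - Real.cos θ) / (2 * Real.pi * (1 - x ^ 2) * √(1 + Real.cos θ - 2 * x ^ 2))
    * (d0 α β γ + d1 θ α β γ * x + d2 θ α β γ * x ^ 2)

/-- The open interval `(-√((1 + c) / 2), √((1 + c) / 2))`. -/
def window (θ : ℝ) : Set ℝ :=
  Ioo (-√((1 + Real.cos θ) / 2)) (√((1 + Real.cos θ) / 2))

/-- The limit law `Δ δ₀ + f(x) 1_{window}(x) dx`, a measure on `ℝ`. -/
def limitLaw (θ : ℝ) (α β γ : ℂ) : Measure ℝ :=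
  ENNReal.ofReal (Delta θ α β γ) • Measure.dirac 0
    + (volume.restrict (window θ)).withDensity fun x => ENNReal.ofReal (density θ α β γ x)

end

end ThreeStateWalk

open ThreeStateWalk

/-! # The limit law of a three-state quantum walk with localization

In momentum space one step of the walk is the multiplication by the unitary matrix
`U(k) = diag(e^{ik}, 1, e^{-ik}) C`, called `evo θ k`. Its eigenvalues are `1`, for every `k`, and
`e^{±iφ(k)}` with `1 - cos φ(k) = gap θ k`. For `k ∈ (0, 2π)` they are distinct, so that
`U(k)^t = ∑ⱼ e^{itωⱼφ(k)} Pⱼ(k)` with `ω = (0, 1, -1)` and explicit projections `Pⱼ` (`evo_pow`).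

*Localization.* The amplitude at a fixed position is a Fourier coefficient of `U(k)^t ψ₀`. The two
oscillating bands contribute nothing in the limit, by the Riemann–Lebesgue lemma, because the
derivative of `φ` vanishes only at `k = π`. What remains is the Fourier coefficient of `P₀ψ₀`, a
trigonometric polynomial divided by `gap θ k`; the Poisson kernel expands `1 / gap θ k` into powers
of `ν` (`tendsto_prob`). The total mass is a sum of geometric series (`hasSum_limitMass`).

*Weak convergence.* By Parseval's formula the characteristic function of `X_t / t` at `ξ` is the
mean over `k` of `⟨U(k + ξ/t)^t ψ₀, U(k)^t ψ₀⟩`. The terms that belong to different eigenvalues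
tend to `0`, since the projections become orthogonal, and the other phases are difference quotients
of `φ`. By dominated convergence the limit is the mean of `∑ⱼ e^{iξωⱼv(k)} ‖Pⱼ(k)ψ₀‖²`, where
`v = -φ'` is the group velocity `speed θ` (`tendsto_charFun`). The band `j = 0` gives the atom, whose
weight is again computed from the Poisson kernel. On `(0, 2π)` the group velocity is a decreasing
bijection to the window, with the inverse `momentum θ`; the substitution `k = momentum θ x`
produces the arcsine-like factor of the density, and the weights of the bands `±1`, combined by the
symmetry `k ↦ 2π - k`, produce its quadratic polynomial (`weight_add_weight`,
`setIntegral_sum_weight`). Lévy's theorem then gives the convergence in distribution, and the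
portmanteau theorem that of the distribution functions. -/

namespace ThreeStateWalk

open Complex Matrix

noncomputable section

variable {θ k x : ℝ} {α β γ : ℂ}

/-! ### The evolution in momentum space and its spectral decomposition -/

/-- The evolution operator in momentum space: the Fourier transform `∑ₓ e^{-ikx} ψ(x)` of a state
is multiplied by this matrix in one step of the walk. -/
def evo (θ k : ℝ) : Matrix (Fin 3) (Fin 3) ℂ :=
  Matrix.diagonal ![cexp (k * I), 1, cexp (-(k * I))] * coin θ

/-- `1 - cos φ`, where `e^{±iφ}` are the eigenvalues of `evo θ k` other than `1`. -/
def gap (θ k : ℝ) : ℝ := (3 - Real.cos θ) / 2 + (1 + Real.cos θ) / 2 * Real.cos k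

/-- The dispersion relation: the eigenvalues of `evo θ k` are `1` and `e^{±i phase θ k}`. -/
def phase (θ k : ℝ) : ℝ := Real.arccos (1 - gap θ k)

/-- The eigenvalues of `evo θ k` are `e^{i (freq j) (phase θ k)}`. -/
def freq : Fin 3 → ℝ := ![0, 1, -1]

/-- The spectral projection of `U = evo θ k` to the eigenvalue `1`, in the form
`(U + U* - 2 cos φ) / (2 (1 - cos φ))`. -/
def flatProj (θ k : ℝ) : Matrix (Fin 3) (Fin 3) ℂ :=
  (2 * gap θ k : ℂ)⁻¹ •
    (evo θ k + (evo θ k)ᴴ - (2 * (1 - gap θ k : ℂ)) • (1 : Matrix (Fin 3) (Fin 3) ℂ))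

/-- The difference `(U - U*) / (2 i sin φ)` of the spectral projections of `U = evo θ k` to the
eigenvalues `e^{iφ}` and `e^{-iφ}`. It has a junk value where `sin φ = 0`. -/
def splitting (θ k : ℝ) : Matrix (Fin 3) (Fin 3) ℂ :=
  (2 * I * Real.sin (phase θ k))⁻¹ • (evo θ k - (evo θ k)ᴴ)

/-- The spectral projections of `evo θ k`, in the order of `freq`. -/
def proj (θ k : ℝ) : Fin 3 → Matrix (Fin 3) (Fin 3) ℂ :=
  ![flatProj θ k, (2 : ℂ)⁻¹ • (1 - flatProj θ k + splitting θ k),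
    (2 : ℂ)⁻¹ • (1 - flatProj θ k - splitting θ k)]

lemma cexp_mul_cexp_neg (z : ℂ) : cexp z * cexp (-z) = 1 := by
  rw [← Complex.exp_add]; simp

lemma star_cexp_mul_I (k : ℝ) : (starRingEnd ℂ) (cexp (k * I)) = cexp (-(k * I)) := by
  rw [← Complex.exp_conj]; simp

lemma star_cexp_neg_mul_I (k : ℝ) : (starRingEnd ℂ) (cexp (-(k * I))) = cexp (k * I) := by
  rw [← Complex.exp_conj]; simp

lemma ofReal_cos_eq (k : ℝ) : ((Real.cos k : ℝ) : ℂ) = (cexp (k * I) + cexp (-(k * I))) / 2 := by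
  rw [Complex.ofReal_cos, Complex.cos]; simp

/-- The entries of the coin are affine in `c = cos θ` and `σ = sin θ / √2`, which satisfy
`2 σ² = 1 - c²`. This makes the matrix identities below polynomial identities. -/
lemma coin_eq (θ : ℝ) : ∃ σ c : ℝ, 2 * (σ : ℂ) ^ 2 = 1 - c ^ 2 ∧
    c = Real.cos θ ∧ σ = Real.sin θ / √2 ∧
    coin θ = !![-(1 + c : ℂ) / 2, σ, (1 - c) / 2; (σ : ℂ), c, σ;
      (1 - c : ℂ) / 2, σ, -(1 + c) / 2] := by
  refine ⟨Real.sin θ / √2, Real.cos θ, ?_, rfl, rfl, ?_⟩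
  · norm_cast
    rw [div_pow, Real.sq_sqrt (by norm_num)]
    linarith [Real.sin_sq_add_cos_sq θ]
  · simp [coin]

lemma coin_conjTranspose (θ : ℝ) : (coin θ)ᴴ = coin θ := by
  obtain ⟨σ, c, -, -, -, hC⟩ := coin_eq θ
  rw [hC]
  ext i j
  fin_cases i <;> fin_cases j <;> simp [-ofReal_cos, -ofReal_sin]

lemma coin_mul_coin (θ : ℝ) : coin θ * coin θ = 1 := by
  obtain ⟨σ, c, h, -, -, hC⟩ := coin_eq θ
  rw [hC]
  ext i j
  fin_cases i <;> fin_cases j <;> simp [Matrix.mul_apply, Fin.sum_univ_three] <;> grind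

lemma evo_eq (θ k : ℝ) : evo θ k = !![cexp (k * I) * coin θ 0 0, cexp (k * I) * coin θ 0 1,
    cexp (k * I) * coin θ 0 2; coin θ 1 0, coin θ 1 1, coin θ 1 2;
    cexp (-(k * I)) * coin θ 2 0, cexp (-(k * I)) * coin θ 2 1, cexp (-(k * I)) * coin θ 2 2] := by
  ext i j
  fin_cases i <;> fin_cases j <;> simp [evo, Matrix.diagonal_mul]

lemma evo_mul_conjTranspose (θ k : ℝ) : evo θ k * (evo θ k)ᴴ = 1 := by
  have : Matrix.diagonal ![cexp (k * I), 1, cexp (-(k * I))] *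
      (Matrix.diagonal ![cexp (k * I), 1, cexp (-(k * I))])ᴴ = 1 := by
    rw [Matrix.diagonal_conjTranspose, Matrix.diagonal_mul_diagonal, ← Matrix.diagonal_one]
    congr 1
    ext i
    have h := cexp_mul_cexp_neg (k * I)
    fin_cases i <;> simp [star_cexp_mul_I, star_cexp_neg_mul_I, h]
    rw [mul_comm, h]
  rw [evo, Matrix.conjTranspose_mul, coin_conjTranspose, Matrix.mul_assoc, ← Matrix.mul_assoc (coin θ),
    coin_mul_coin, Matrix.one_mul, this]

lemma conjTranspose_mul_evo (θ k : ℝ) : (evo θ k)ᴴ * evo θ k = 1 :=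
  mul_eq_one_comm.mp (evo_mul_conjTranspose θ k)

/-- The characteristic equation: `1` is an eigenvalue for every momentum, and the two other
eigenvalues have sum `2 (1 - gap θ k)`. -/
lemma evo_sub_one_mul (θ k : ℝ) : (evo θ k - 1) * (evo θ k + (evo θ k)ᴴ -
    (2 * (1 - gap θ k : ℂ)) • (1 : Matrix (Fin 3) (Fin 3) ℂ)) = 0 := by
  obtain ⟨σ, c, h, hc, -, hC⟩ := coin_eq θ
  have hE := cexp_mul_cexp_neg (k * I)
  have hg : (2 * (1 - gap θ k : ℂ)) =
      c - 1 - (1 + c) * (cexp (k * I) + cexp (-(k * I))) / 2 := by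
    rw [gap, ← hc]
    push_cast
    rw [← ofReal_cos, ofReal_cos_eq]
    ring
  rw [hg, evo_eq, hC]
  ext i j
  fin_cases i <;> fin_cases j <;>
    simp [Matrix.mul_apply, Fin.sum_univ_three, Matrix.one_apply, star_cexp_mul_I,
      star_cexp_neg_mul_I, map_ofNat] <;> grind

lemma gap_pos {θ : ℝ} (h1 : Real.cos θ < 1) (k : ℝ) : 0 < gap θ k := by
  unfold gap
  nlinarith [Real.neg_one_le_cos k, Real.neg_one_le_cos θ]

lemma gap_le_two (θ k : ℝ) : gap θ k ≤ 2 := by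
  unfold gap
  nlinarith [Real.cos_le_one k, Real.neg_one_le_cos θ]

lemma cos_lt_one_of_mem {k : ℝ} (hk : k ∈ Ioo 0 (2 * Real.pi)) : Real.cos k < 1 := by
  refine lt_of_le_of_ne (Real.cos_le_one k) fun h => ?_
  have := (Real.cos_eq_one_iff_of_lt_of_lt (by linarith [hk.1, hk.2]) hk.2).mp h
  exact hk.1.ne' this

lemma gap_lt_two {θ k : ℝ} (h0 : -1 < Real.cos θ) (hk : k ∈ Ioo 0 (2 * Real.pi)) :
    gap θ k < 2 := by
  unfold gap
  nlinarith [cos_lt_one_of_mem hk]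

lemma cos_phase {θ : ℝ} (h1 : Real.cos θ < 1) (k : ℝ) : Real.cos (phase θ k) = 1 - gap θ k :=
  Real.cos_arccos (by linarith [gap_le_two θ k]) (by linarith [gap_pos h1 k])

lemma sin_phase_pos {θ k : ℝ} (h0 : -1 < Real.cos θ) (h1 : Real.cos θ < 1)
    (hk : k ∈ Ioo 0 (2 * Real.pi)) : 0 < Real.sin (phase θ k) := by
  rw [phase, Real.sin_arccos]
  apply Real.sqrt_pos.mpr
  nlinarith [gap_pos h1 k, gap_lt_two h0 hk]

lemma sin_phase_sq {θ : ℝ} (h1 : Real.cos θ < 1) (k : ℝ) :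
    Real.sin (phase θ k) ^ 2 = gap θ k * (2 - gap θ k) := by
  have := Real.sin_sq_add_cos_sq (phase θ k)
  rw [cos_phase h1] at this
  linarith

/-- Products of `X = U + V - 2C` and `D = U - V` for a unitary `U` with adjoint `V` that satisfies
the characteristic equation `(U - 1) X = 0`. -/
lemma mul_relations {A : Type*} [Ring A] [Algebra ℂ A] {U V : A} {C : ℂ} (hUV : U * V = 1)
    (hVU : V * U = 1) (h : (U - 1) * (U + V - (2 * C) • (1 : A)) = 0) :
    let X := U + V - (2 * C) • (1 : A)
    X * X = (2 - 2 * C) • X ∧ X * (U - V) = 0 ∧ (U - V) * X = 0 ∧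
      (U - V) * (U - V) = (2 + 2 * C) • X - (4 - 4 * C ^ 2) • (1 : A) := by
  intro X
  have hUX : U * X = X := by simpa [sub_mul, sub_eq_zero] using h
  have hVX : V * X = X := by
    conv_lhs => rw [← hUX]
    rw [← mul_assoc, hVU, one_mul]
  have hcU : X * U = U * X := by simp [X, mul_add, add_mul, sub_mul, mul_sub, hUV, hVU]
  have hcV : X * V = V * X := by simp [X, mul_add, add_mul, sub_mul, mul_sub, hUV, hVU]
  have hXX : X * X = (2 - 2 * C) • X := by
    conv_lhs => enter [1]; simp only [X]
    rw [sub_mul, add_mul, hUX, hVX, smul_mul_assoc, one_mul]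
    module
  refine ⟨hXX, by rw [mul_sub, hcU, hcV, hUX, hVX, sub_self],
    by rw [sub_mul, hUX, hVX, sub_self], ?_⟩
  have hUV' : U + V = X + (2 * C) • (1 : A) := by simp [X]
  have : (U - V) * (U - V) = (U + V) * (U + V) - (4 : ℂ) • (1 : A) := by
    simp only [mul_add, add_mul, sub_mul, mul_sub, hUV, hVU]
    module
  rw [this, hUV']
  simp only [mul_add, add_mul, smul_mul_assoc, mul_smul_comm, one_mul, mul_one, hXX]
  module

lemma proj_mul_proj (h0 : -1 < Real.cos θ) (h1 : Real.cos θ < 1) (hk : k ∈ Ioo 0 (2 * Real.pi))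
    (i j : Fin 3) : proj θ k i * proj θ k j = if i = j then proj θ k i else 0 := by
  obtain ⟨hXX, hXD, hDX, hDD⟩ := mul_relations (evo_mul_conjTranspose θ k)
    (conjTranspose_mul_evo θ k) (evo_sub_one_mul θ k)
  have hg : (gap θ k : ℂ) ≠ 0 := by exact_mod_cast (gap_pos h1 k).ne'
  have hg2 : (2 - gap θ k : ℂ) ≠ 0 := by
    exact_mod_cast (sub_pos.mpr (gap_lt_two h0 hk)).ne'
  have hS2 : (Real.sin (phase θ k) : ℂ) ^ 2 = gap θ k * (2 - gap θ k) := by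
    exact_mod_cast sin_phase_sq h1 k
  have hI : (2 * I * Real.sin (phase θ k))⁻¹ * (2 * I * Real.sin (phase θ k))⁻¹ =
      -(4 * gap θ k * (2 - gap θ k) : ℂ)⁻¹ := by
    rw [← mul_inv, ← inv_neg]
    congr 1
    linear_combination -4 * hS2 + 4 * (Real.sin (phase θ k) : ℂ) ^ 2 * I_sq
  have hPP : flatProj θ k * flatProj θ k = flatProj θ k := by
    simp only [flatProj, smul_mul_smul_comm, hXX, smul_smul]
    congr 1
    field_simp
    ring
  have hPD : flatProj θ k * splitting θ k = 0 := by
    simp only [flatProj, splitting, smul_mul_smul_comm, hXD, smul_zero]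
  have hDP : splitting θ k * flatProj θ k = 0 := by
    simp only [flatProj, splitting, smul_mul_smul_comm, hDX, smul_zero]
  have hDD' : splitting θ k * splitting θ k = 1 - flatProj θ k := by
    simp only [flatProj, splitting, smul_mul_smul_comm, hDD, hI]
    generalize evo θ k + (evo θ k)ᴴ - (2 * (1 - gap θ k : ℂ)) • 1 = Y
    match_scalars <;> field_simp <;> ring
  fin_cases i <;> fin_cases j <;>
    simp [proj, mul_add, add_mul, sub_mul, mul_sub, hPP, hPD, hDP, hDD'] <;> module

lemma sum_proj (θ k : ℝ) : ∑ j, proj θ k j = 1 := by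
  simp only [proj, Fin.sum_univ_three]
  simp
  module

lemma proj_conjTranspose (θ k : ℝ) (j : Fin 3) : (proj θ k j)ᴴ = proj θ k j := by
  fin_cases j <;>
  simp [proj, flatProj, splitting, Matrix.conjTranspose_add, Matrix.conjTranspose_sub, Matrix.conjTranspose_smul,
    -_root_.mul_inv_rev, -Complex.ofReal_sin] <;> module

lemma evo_eq_sum (h0 : -1 < Real.cos θ) (h1 : Real.cos θ < 1) (hk : k ∈ Ioo 0 (2 * Real.pi)) :
    evo θ k = ∑ j, cexp (freq j * phase θ k * I) • proj θ k j := by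
  have hg : (gap θ k : ℂ) ≠ 0 := by exact_mod_cast (gap_pos h1 k).ne'
  have hS : (Real.sin (phase θ k) : ℂ) ≠ 0 := by exact_mod_cast (sin_phase_pos h0 h1 hk).ne'
  have e1 : cexp (phase θ k * I) = (1 - gap θ k) + Real.sin (phase θ k) * I := by
    rw [Complex.exp_mul_I, ← Complex.ofReal_cos, cos_phase h1]; simp
  have e2 : cexp (-(phase θ k) * I) = (1 - gap θ k) - Real.sin (phase θ k) * I := by
    rw [Complex.exp_mul_I, Complex.cos_neg, Complex.sin_neg, ← Complex.ofReal_cos, cos_phase h1]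
    simp; ring
  simp only [Fin.sum_univ_three, freq, proj, flatProj, splitting]
  simp [e1, -_root_.mul_inv_rev, -Complex.ofReal_sin]
  rw [← neg_mul, e2]
  generalize (Real.sin (phase θ k) : ℂ) = S at *
  generalize (gap θ k : ℂ) = g at *
  have hI0 := Complex.I_ne_zero
  match_scalars <;> field_simp <;> ring

lemma evo_pow (h0 : -1 < Real.cos θ) (h1 : Real.cos θ < 1) (hk : k ∈ Ioo 0 (2 * Real.pi)) (t : ℕ) :
    evo θ k ^ t = ∑ j, cexp (t * (freq j * phase θ k) * I) • proj θ k j := by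
  induction t with
  | zero => simp [sum_proj]
  | succ t ih =>
    rw [pow_succ, ih]
    nth_rewrite 1 [evo_eq_sum h0 h1 hk]
    rw [Finset.sum_mul]
    refine Finset.sum_congr rfl fun i _ => ?_
    rw [Finset.mul_sum, Finset.sum_eq_single i]
    · rw [smul_mul_smul_comm, proj_mul_proj h0 h1 hk, if_pos rfl, ← Complex.exp_add]
      push_cast
      ring_nf
    · intro j _ hj
      rw [smul_mul_smul_comm, proj_mul_proj h0 h1 hk, if_neg hj.symm, smul_zero]
    · simp

/-! ### The walk in momentum space -/

lemma continuous_evo (θ : ℝ) : Continuous (evo θ) := by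
  refine continuous_matrix fun i j => ?_
  simp only [evo_eq]
  fin_cases i <;> fin_cases j <;> simp <;> fun_prop

lemma continuous_evo_pow_mulVec (θ : ℝ) (t : ℕ) (v : Fin 3 → ℂ) :
    Continuous fun k => evo θ k ^ t *ᵥ v :=
  ((continuous_evo θ).pow t).matrix_mulVec continuous_const

lemma setIntegral_cexp_int (n : ℤ) :
    ∫ k in Ioo (0 : ℝ) (2 * Real.pi), cexp (k * n * I) = if n = 0 then 2 * Real.pi else 0 := by
  have hpi := Real.pi_pos
  rw [← integral_Ioc_eq_integral_Ioo, ← intervalIntegral.integral_of_le (by positivity)]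
  split_ifs with h
  · simp [h]
  · have hn : (n * I : ℂ) ≠ 0 := mul_ne_zero (by exact_mod_cast h) I_ne_zero
    have := integral_exp_mul_complex (a := 0) (b := 2 * Real.pi) hn
    have e : cexp (n * I * (2 * Real.pi : ℝ)) = 1 := by
      rw [Complex.exp_eq_one_iff]
      exact ⟨n, by push_cast; ring⟩
    rw [e] at this
    simp only [ofReal_zero, mul_zero, Complex.exp_zero, sub_self, zero_div] at this
    simp only [ofReal_zero]
    rw [← this]
    congr 1
    ext k
    ring_nf

lemma hasSum_of_terms_eq {ι M : Type*} [AddCommMonoid M] [TopologicalSpace M] {f g : ι → M} {a : M}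
    (hf : HasSum f a) (h : ∀ x, g x = f x) :
    HasSum g a := by
  rwa [funext h]

lemma amplitude_succ (θ : ℝ) (α β γ : ℂ) (t : ℕ) :
    amplitude θ α β γ (t + 1) = step θ (amplitude θ α β γ t) :=
  Function.iterate_succ_apply' _ _ _

lemma step_zero (θ : ℝ) (ψ : ℤ → Fin 3 → ℂ) (x : ℤ) :
    step θ ψ x 0 = (coin θ *ᵥ ψ (x + 1)) 0 := rfl

lemma step_one (θ : ℝ) (ψ : ℤ → Fin 3 → ℂ) (x : ℤ) :
    step θ ψ x 1 = (coin θ *ᵥ ψ x) 1 := rfl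

lemma step_two (θ : ℝ) (ψ : ℤ → Fin 3 → ℂ) (x : ℤ) :
    step θ ψ x 2 = (coin θ *ᵥ ψ (x - 1)) 2 := rfl

/-- The amplitude spreads with speed at most `1`. -/
lemma amplitude_eq_zero (θ : ℝ) (α β γ : ℂ) {t : ℕ} {x : ℤ} (h : (t : ℤ) < |x|) :
    amplitude θ α β γ t x = 0 := by
  induction t generalizing x with
  | zero =>
    have : x ≠ 0 := by rintro rfl; simp at h
    simp [amplitude, initial, this]
  | succ t ih =>
    have e : ∀ y : ℤ, |y - x| ≤ 1 → amplitude θ α β γ t y = 0 := fun y hy => ih (by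
      have := abs_sub_abs_le_abs_sub x y
      rw [abs_sub_comm] at this
      push_cast at h
      linarith)
    rw [amplitude_succ]
    ext j
    match j with
    | 0 => simp [step_zero, e]
    | 1 => simp [step_one, e]
    | 2 => simp [step_two, e]

/-- The Fourier transform of the amplitude evolves by the powers of `evo θ k`. -/
lemma hasSum_amplitude (θ : ℝ) (α β γ : ℂ) (t : ℕ) (k : ℝ) (j : Fin 3) :
    HasSum (fun x : ℤ => cexp (-(k * x * I)) * amplitude θ α β γ t x j)
      ((evo θ k ^ t *ᵥ ![α, β, γ]) j) := by
  induction t generalizing j with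
  | zero =>
    convert hasSum_ite_eq (0 : ℤ) (![α, β, γ] j) using 2 with x
    · by_cases hx : x = 0 <;> simp [amplitude, initial, hx]
    · simp
  | succ t ih =>
    have hC : ∀ i, HasSum (fun x : ℤ => cexp (-(k * x * I)) *
        (coin θ *ᵥ amplitude θ α β γ t x) i) ((coin θ *ᵥ (evo θ k ^ t *ᵥ ![α, β, γ])) i) := by
      intro i
      have := hasSum_sum (s := Finset.univ) fun l _ => (ih l).mul_left (coin θ i l)
      refine hasSum_of_terms_eq this fun x => ?_
      simp only [Matrix.mulVec, dotProduct, Finset.mul_sum]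
      exact Finset.sum_congr rfl fun l _ => by ring
    have hU : evo θ k ^ (t + 1) *ᵥ ![α, β, γ] =
        Matrix.diagonal ![cexp (k * I), 1, cexp (-(k * I))] *ᵥ
          (coin θ *ᵥ (evo θ k ^ t *ᵥ ![α, β, γ])) := by
      rw [pow_succ', ← Matrix.mulVec_mulVec, evo, ← Matrix.mulVec_mulVec]
    rw [hU, amplitude_succ]
    match j with
    | 0 =>
      have := ((Equiv.addRight (1 : ℤ)).hasSum_iff.mpr (hC 0)).mul_left (cexp (k * I))
      rw [Matrix.mulVec_diagonal]
      refine hasSum_of_terms_eq this fun x => ?_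
      simp only [step_zero, Function.comp, Equiv.coe_addRight, ← mul_assoc, ← Complex.exp_add]
      congr 2
      push_cast
      ring
    | 1 => simpa [Matrix.mulVec_diagonal, step_one] using hC 1
    | 2 =>
      have := ((Equiv.addRight (-1 : ℤ)).hasSum_iff.mpr (hC 2)).mul_left (cexp (-(k * I)))
      rw [Matrix.mulVec_diagonal]
      refine hasSum_of_terms_eq this fun x => ?_
      simp only [step_two, Function.comp, Equiv.coe_addRight, ← mul_assoc, ← Complex.exp_add]
      congr 2
      push_cast
      ring

lemma evo_pow_mulVec_eq_sum (θ : ℝ) (α β γ : ℂ) (t : ℕ) (k : ℝ) (j : Fin 3) :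
    (evo θ k ^ t *ᵥ ![α, β, γ]) j =
      ∑ x ∈ Finset.Icc (-t : ℤ) t, cexp (-(k * x * I)) * amplitude θ α β γ t x j := by
  refine (hasSum_amplitude θ α β γ t k j).unique (hasSum_sum_of_ne_finset_zero fun x hx => ?_)
  rw [amplitude_eq_zero θ α β γ (not_le.mp fun h => hx (Finset.mem_Icc.mpr (abs_le.mp h)))]
  simp

/-- Fourier inversion for the amplitude. -/
lemma amplitude_eq_integral (θ : ℝ) (α β γ : ℂ) (t : ℕ) (x : ℤ) (j : Fin 3) :
    amplitude θ α β γ t x j = (2 * Real.pi : ℂ)⁻¹ *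
      ∫ k in Ioo (0 : ℝ) (2 * Real.pi), cexp (k * x * I) * (evo θ k ^ t *ᵥ ![α, β, γ]) j := by
  have hpi : (2 * Real.pi : ℂ) ≠ 0 := by exact_mod_cast (by positivity : 2 * Real.pi ≠ 0)
  have e : ∀ k : ℝ, cexp (k * x * I) * (evo θ k ^ t *ᵥ ![α, β, γ]) j =
      ∑ y ∈ Finset.Icc (-t : ℤ) t, amplitude θ α β γ t y j * cexp (k * (x - y : ℤ) * I) := by
    intro k
    rw [evo_pow_mulVec_eq_sum, Finset.mul_sum]
    refine Finset.sum_congr rfl fun y _ => ?_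
    rw [← mul_assoc, ← Complex.exp_add, mul_comm]
    push_cast
    ring_nf
  simp_rw [e]
  rw [integral_finsetSum]
  · simp_rw [integral_const_mul, setIntegral_cexp_int, sub_eq_zero]
    by_cases hx : x ∈ Finset.Icc (-t : ℤ) t
    · rw [Finset.sum_eq_single x]
      · simp; field_simp
      · intro y _ hy
        simp [hy.symm]
      · exact fun h => absurd hx h
    · rw [amplitude_eq_zero θ α β γ (not_le.mp fun h => hx (Finset.mem_Icc.mpr (abs_le.mp h))),
        Finset.sum_eq_zero]
      · simp
      · intro y hy
        have : x ≠ y := by rintro rfl; exact hx hy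
        simp [this]
  · intro y _
    refine (Continuous.integrableOn_Icc (a := 0) (b := 2 * Real.pi) ?_).mono_set Ioo_subset_Icc_self
    fun_prop

/-- Parseval's formula: the characteristic function of the position, in momentum space. -/
lemma hasSum_prob (θ : ℝ) (α β γ : ℂ) (t : ℕ) (η : ℝ) :
    HasSum (fun x : ℤ => cexp (η * x * I) * prob θ α β γ t x) ((2 * Real.pi : ℂ)⁻¹ *
      ∫ k in Ioo (0 : ℝ) (2 * Real.pi),
        star (evo θ (k + η) ^ t *ᵥ ![α, β, γ]) ⬝ᵥ (evo θ k ^ t *ᵥ ![α, β, γ])) := by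
  have e : ∀ k : ℝ, star (evo θ (k + η) ^ t *ᵥ ![α, β, γ]) ⬝ᵥ (evo θ k ^ t *ᵥ ![α, β, γ]) =
      ∑ j, ∑ x ∈ Finset.Icc (-t : ℤ) t, (cexp (η * x * I) * star (amplitude θ α β γ t x j)) *
        (cexp (k * x * I) * (evo θ k ^ t *ᵥ ![α, β, γ]) j) := by
    intro k
    refine Finset.sum_congr rfl fun j _ => ?_
    rw [Pi.star_apply, evo_pow_mulVec_eq_sum θ α β γ t (k + η), star_sum, Finset.sum_mul]
    refine Finset.sum_congr rfl fun x _ => ?_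
    have : star (cexp (-((k + η : ℝ) * x * I))) = cexp (η * x * I) * cexp (k * x * I) := by
      rw [← Complex.exp_add, RCLike.star_def, ← Complex.exp_conj]
      congr 1
      simp
      ring
    rw [star_mul', this]
    ring
  have hint : ∀ j (x : ℤ), IntegrableOn (fun k : ℝ => (cexp (η * x * I) *
      star (amplitude θ α β γ t x j)) * (cexp (k * x * I) * (evo θ k ^ t *ᵥ ![α, β, γ]) j))
      (Ioo (0 : ℝ) (2 * Real.pi)) := by
    intro j x
    refine (Continuous.integrableOn_Icc (a := 0) (b := 2 * Real.pi) ?_).mono_set Ioo_subset_Icc_self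
    have h1 : Continuous fun k : ℝ => cexp (k * x * I) := by fun_prop
    exact continuous_const.mul
      (h1.mul (continuous_pi_iff.mp (continuous_evo_pow_mulVec θ t ![α, β, γ]) j))
  simp_rw [e]
  rw [integral_finsetSum _ fun j _ => integrable_finsetSum _ fun x _ => hint j x]
  simp_rw [integral_finsetSum _ fun x _ => hint _ x, integral_const_mul]
  rw [Finset.sum_comm, Finset.mul_sum]
  have hs : ∑ x ∈ Finset.Icc (-t : ℤ) t, cexp (η * x * I) * prob θ α β γ t x =
      ∑ x ∈ Finset.Icc (-t : ℤ) t, (2 * Real.pi : ℂ)⁻¹ * ∑ j, cexp (η * x * I) *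
        star (amplitude θ α β γ t x j) * ∫ k in Ioo (0 : ℝ) (2 * Real.pi),
          cexp (k * x * I) * (evo θ k ^ t *ᵥ ![α, β, γ]) j := by
    refine Finset.sum_congr rfl fun x _ => ?_
    rw [prob, ofReal_sum, Finset.mul_sum, Finset.mul_sum]
    refine Finset.sum_congr rfl fun j _ => ?_
    rw [mul_left_comm, ← amplitude_eq_integral, mul_assoc (cexp _) (star _), RCLike.star_def,
      Complex.conj_mul']
    push_cast
    rfl
  rw [← hs]
  refine hasSum_sum_of_ne_finset_zero fun x hx => ?_
  simp [prob, amplitude_eq_zero θ α β γ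
    (not_le.mp fun h => hx (Finset.mem_Icc.mpr (abs_le.mp h)))]

lemma star_dotProduct_self (v : Fin 3 → ℂ) : star v ⬝ᵥ v = ((∑ j, ‖v j‖ ^ 2 : ℝ) : ℂ) := by
  simp only [dotProduct, Pi.star_apply, RCLike.star_def, Complex.conj_mul']
  push_cast
  rfl

lemma star_evo_pow_mulVec (θ k : ℝ) (t : ℕ) (v : Fin 3 → ℂ) :
    star (evo θ k ^ t *ᵥ v) ⬝ᵥ (evo θ k ^ t *ᵥ v) = star v ⬝ᵥ v := by
  induction t with
  | zero => simp
  | succ t ih =>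
    rw [pow_succ', ← Matrix.mulVec_mulVec, Matrix.star_mulVec, ← Matrix.dotProduct_mulVec,
      Matrix.mulVec_mulVec, conjTranspose_mul_evo, Matrix.one_mulVec, ih]

lemma sum_norm_sq_evo_pow_mulVec (hnorm : ‖α‖ ^ 2 + ‖β‖ ^ 2 + ‖γ‖ ^ 2 = 1) (k : ℝ) (t : ℕ) :
    ∑ j, ‖(evo θ k ^ t *ᵥ ![α, β, γ]) j‖ ^ 2 = 1 := by
  have := star_evo_pow_mulVec θ k t ![α, β, γ]
  rw [star_dotProduct_self, star_dotProduct_self] at this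
  rw [Complex.ofReal_inj.mp this]
  simpa [Fin.sum_univ_three] using hnorm

lemma norm_star_dotProduct_le {u v : Fin 3 → ℂ} (hu : ∑ j, ‖u j‖ ^ 2 = 1)
    (hv : ∑ j, ‖v j‖ ^ 2 = 1) : ‖star u ⬝ᵥ v‖ ≤ 1 := by
  have h : ∀ j, ‖star u j * v j‖ ≤ (‖u j‖ ^ 2 + ‖v j‖ ^ 2) / 2 := fun j => by
    rw [norm_mul, Pi.star_apply, norm_star]
    nlinarith [sq_nonneg (‖u j‖ - ‖v j‖)]
  refine (norm_sum_le _ _).trans ((Finset.sum_le_sum fun j _ => h j).trans ?_)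
  rw [← Finset.sum_div, Finset.sum_add_distrib, hu, hv]
  norm_num

lemma prob_nonneg (t : ℕ) (x : ℤ) : 0 ≤ prob θ α β γ t x :=
  Finset.sum_nonneg fun _ _ => by positivity

lemma hasSum_prob_one (hnorm : ‖α‖ ^ 2 + ‖β‖ ^ 2 + ‖γ‖ ^ 2 = 1) (t : ℕ) :
    HasSum (prob θ α β γ t) 1 := by
  have h := hasSum_prob θ α β γ t 0
  have hpi : (2 * Real.pi : ℂ) ≠ 0 := by exact_mod_cast (by positivity : 2 * Real.pi ≠ 0)
  simp only [add_zero, star_dotProduct_self, sum_norm_sq_evo_pow_mulVec hnorm] at h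
  rw [setIntegral_const] at h
  have e : (2 * Real.pi : ℂ)⁻¹ * (volume.real (Ioo 0 (2 * Real.pi)) • ((1 : ℝ) : ℂ)) =
      ((1 : ℝ) : ℂ) := by
    rw [Real.volume_real_Ioo_of_le (by positivity)]
    simp only [sub_zero, ofReal_one, real_smul, ofReal_mul, ofReal_ofNat, mul_one]
    exact inv_mul_cancel₀ hpi
  rw [e] at h
  simp only [ofReal_zero, zero_mul, Complex.exp_zero, one_mul] at h
  exact_mod_cast h

lemma isProbabilityMeasure_law (hnorm : ‖α‖ ^ 2 + ‖β‖ ^ 2 + ‖γ‖ ^ 2 = 1) (t : ℕ) :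
    IsProbabilityMeasure (law θ α β γ t) := by
  constructor
  rw [law, Measure.sum_apply _ MeasurableSet.univ]
  simp only [Measure.smul_apply, measure_univ, smul_eq_mul, mul_one]
  rw [← ENNReal.ofReal_tsum_of_nonneg (fun x => prob_nonneg t x) (hasSum_prob_one hnorm t).summable,
    (hasSum_prob_one hnorm t).tsum_eq, ENNReal.ofReal_one]

/-- The characteristic function of `X_t / t`, in momentum space. -/
lemma charFun_law_map (hnorm : ‖α‖ ^ 2 + ‖β‖ ^ 2 + ‖γ‖ ^ 2 = 1) (t : ℕ) (ξ : ℝ) :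
    charFun ((law θ α β γ t).map fun n : ℤ => (n : ℝ) / t) ξ = (2 * Real.pi : ℂ)⁻¹ *
      ∫ k in Ioo (0 : ℝ) (2 * Real.pi),
        star (evo θ (k + ξ / t) ^ t *ᵥ ![α, β, γ]) ⬝ᵥ (evo θ k ^ t *ᵥ ![α, β, γ]) := by
  have := isProbabilityMeasure_law (θ := θ) hnorm t
  rw [charFun_apply_real, integral_map (measurable_of_countable _).aemeasurable
    (by fun_prop : Continuous fun x : ℝ => cexp (ξ * x * I)).aestronglyMeasurable]
  have hi : Integrable (fun n : ℤ => cexp (ξ * ((n : ℝ) / t : ℝ) * I)) (law θ α β γ t) := by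
    refine Integrable.of_bound (measurable_of_countable _).aestronglyMeasurable 1
      (ae_of_all _ fun n => ?_)
    rw [← ofReal_mul, Complex.norm_exp_ofReal_mul_I]
  have h := hasSum_integral_measure hi
  refine h.unique ?_
  refine hasSum_of_terms_eq (hasSum_prob θ α β γ t (ξ / t)) fun n => ?_
  rw [integral_smul_measure, integral_dirac, ENNReal.toReal_ofReal (prob_nonneg t n),
    Complex.real_smul, mul_comm]
  congr 2
  push_cast
  ring

/-! ### Group velocity and the limit of the characteristic functions -/

/-- The group velocity of the eigenvalue `e^{i phase θ k}`, which is minus the derivative of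
`phase θ`; it is written in half angles, so that it is smooth on `(0, 2π)`. -/
def speed (θ k : ℝ) : ℝ := √(1 + Real.cos θ) * Real.cos (k / 2) / √(gap θ k)

/-- The squared norm of the component of the initial state in the range of `proj θ k j`. -/
def weight (θ : ℝ) (α β γ : ℂ) (k : ℝ) (j : Fin 3) : ℝ :=
  ∑ i, ‖(proj θ k j *ᵥ ![α, β, γ]) i‖ ^ 2

lemma cos_eq_half (k : ℝ) : Real.cos k = 1 - 2 * Real.sin (k / 2) ^ 2 := by
  have := Real.cos_two_mul (k / 2)
  have h2 := Real.sin_sq_add_cos_sq (k / 2)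
  rw [mul_div_cancel₀ _ (two_ne_zero)] at this
  linarith

lemma two_sub_gap (θ k : ℝ) : 2 - gap θ k = (1 + Real.cos θ) * Real.sin (k / 2) ^ 2 := by
  rw [gap, cos_eq_half k]
  ring

lemma sin_half_pos (hk : k ∈ Ioo 0 (2 * Real.pi)) : 0 < Real.sin (k / 2) :=
  Real.sin_pos_of_pos_of_lt_pi (by linarith [hk.1]) (by linarith [hk.2])

lemma sin_phase_eq (h1 : Real.cos θ < 1) (hk : k ∈ Ioo 0 (2 * Real.pi)) :
    Real.sin (phase θ k) = √(gap θ k) * (√(1 + Real.cos θ) * Real.sin (k / 2)) := by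
  rw [phase, Real.sin_arccos,
    show 1 - (1 - gap θ k) ^ 2 = gap θ k * (2 - gap θ k) by ring, two_sub_gap,
    Real.sqrt_mul (gap_pos h1 k).le, Real.sqrt_mul' _ (sq_nonneg _),
    Real.sqrt_sq (sin_half_pos hk).le]

lemma hasDerivAt_phase (h0 : -1 < Real.cos θ) (h1 : Real.cos θ < 1)
    (hk : k ∈ Ioo 0 (2 * Real.pi)) : HasDerivAt (phase θ) (-speed θ k) k := by
  have hg := gap_pos h1 k
  have hg2 := gap_lt_two h0 hk
  have hd : HasDerivAt (fun k => 1 - gap θ k) ((1 + Real.cos θ) / 2 * Real.sin k) k := by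
    have := ((((Real.hasDerivAt_cos k).const_mul ((1 + Real.cos θ) / 2)).const_add
      ((3 - Real.cos θ) / 2))).const_sub 1
    simpa [gap] using this
  have := (Real.hasDerivAt_arccos (x := 1 - gap θ k) (by linarith) (by linarith)).comp k hd
  refine this.congr_deriv ?_
  have hs := sin_phase_eq h1 hk
  rw [phase, Real.sin_arccos] at hs
  have hsin : Real.sin k = 2 * Real.sin (k / 2) * Real.cos (k / 2) := by
    rw [← Real.sin_two_mul, mul_div_cancel₀ _ two_ne_zero]
  have hc : 0 < 1 + Real.cos θ := by linarith
  rw [hs, hsin, speed]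
  have := Real.sq_sqrt hc.le
  have h3 := (Real.sqrt_pos.mpr hc).ne'
  have h4 := (Real.sqrt_pos.mpr hg).ne'
  have h5 := (sin_half_pos hk).ne'
  field_simp
  rw [this]

lemma continuous_gap (θ : ℝ) : Continuous (gap θ) := by unfold gap; fun_prop

lemma continuous_phase (θ : ℝ) : Continuous (phase θ) :=
  Real.continuous_arccos.comp (continuous_const.sub (continuous_gap θ))

lemma continuous_evo_conjTranspose (θ : ℝ) : Continuous fun k => (evo θ k)ᴴ :=
  (continuous_evo θ).matrix_conjTranspose

lemma continuous_flatProj (h1 : Real.cos θ < 1) : Continuous (flatProj θ) := by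
  have hg : ∀ k, (2 * gap θ k : ℂ) ≠ 0 := fun k => by exact_mod_cast (by linarith [gap_pos h1 k])
  have h : Continuous fun k => (gap θ k : ℂ) := continuous_ofReal.comp (continuous_gap θ)
  have h2 : Continuous fun k => (2 * gap θ k : ℂ) := continuous_const.mul h
  exact (h2.inv₀ hg).smul
    (((continuous_evo θ).add (continuous_evo_conjTranspose θ)).sub
      ((continuous_const.mul (continuous_const.sub h)).smul continuous_const))

lemma continuousAt_proj (h0 : -1 < Real.cos θ) (h1 : Real.cos θ < 1)
    (hk : k ∈ Ioo 0 (2 * Real.pi)) (j : Fin 3) : ContinuousAt (fun k => proj θ k j) k := by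
  have hP := (continuous_flatProj h1).continuousAt (x := k)
  have hD : ContinuousAt (splitting θ) k := by
    have hc : Continuous fun k => (2 * I * Real.sin (phase θ k) : ℂ) :=
      continuous_const.mul (continuous_ofReal.comp
        (Real.continuous_sin.comp (continuous_phase θ)))
    have hS : (2 * I * Real.sin (phase θ k) : ℂ) ≠ 0 := by
      have : (Real.sin (phase θ k) : ℂ) ≠ 0 := by exact_mod_cast (sin_phase_pos h0 h1 hk).ne'
      simp [this, -Complex.ofReal_sin]
    exact (hc.continuousAt.inv₀ hS).smul
      ((continuous_evo θ).sub (continuous_evo_conjTranspose θ)).continuousAt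
  have hc : ContinuousAt (fun _ : ℝ => (1 : Matrix (Fin 3) (Fin 3) ℂ)) k := continuousAt_const
  match j with
  | 0 => exact hP
  | 1 => exact ((hc.sub hP).add hD).const_smul (2 : ℂ)⁻¹
  | 2 => exact ((hc.sub hP).sub hD).const_smul (2 : ℂ)⁻¹

lemma star_proj_mulVec (h0 : -1 < Real.cos θ) (h1 : Real.cos θ < 1)
    (hk : k ∈ Ioo 0 (2 * Real.pi)) (i j : Fin 3) :
    star (proj θ k i *ᵥ ![α, β, γ]) ⬝ᵥ (proj θ k j *ᵥ ![α, β, γ]) =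
      if i = j then (weight θ α β γ k j : ℂ) else 0 := by
  split_ifs with h
  · subst h
    rw [star_dotProduct_self, weight]
  · rw [Matrix.star_mulVec, ← Matrix.dotProduct_mulVec, Matrix.mulVec_mulVec, proj_conjTranspose,
      proj_mul_proj h0 h1 hk, if_neg h, Matrix.zero_mulVec, dotProduct_zero]

/-- The weights are the quadratic forms of the projections. -/
lemma weight_eq (h0 : -1 < Real.cos θ) (h1 : Real.cos θ < 1)
    (hk : k ∈ Ioo 0 (2 * Real.pi)) (j : Fin 3) :
    (weight θ α β γ k j : ℂ) = star ![α, β, γ] ⬝ᵥ (proj θ k j *ᵥ ![α, β, γ]) := by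
  have := star_proj_mulVec (α := α) (β := β) (γ := γ) h0 h1 hk j j
  rw [if_pos rfl] at this
  rw [← this, Matrix.star_mulVec, ← Matrix.dotProduct_mulVec, Matrix.mulVec_mulVec,
    proj_conjTranspose, proj_mul_proj h0 h1 hk, if_pos rfl]

lemma weight_nonneg (θ : ℝ) (α β γ : ℂ) (k : ℝ) (j : Fin 3) : 0 ≤ weight θ α β γ k j :=
  Finset.sum_nonneg fun _ _ => by positivity

lemma sum_weight (h0 : -1 < Real.cos θ) (h1 : Real.cos θ < 1)
    (hk : k ∈ Ioo 0 (2 * Real.pi)) (hnorm : ‖α‖ ^ 2 + ‖β‖ ^ 2 + ‖γ‖ ^ 2 = 1) :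
    ∑ j, weight θ α β γ k j = 1 := by
  have : ((∑ j, weight θ α β γ k j : ℝ) : ℂ) = 1 := by
    push_cast
    simp_rw [weight_eq h0 h1 hk]
    rw [← dotProduct_sum, ← Matrix.sum_mulVec, sum_proj, Matrix.one_mulVec, star_dotProduct_self]
    norm_cast
    simpa [Fin.sum_univ_three] using hnorm
  exact_mod_cast this

lemma weight_le_one (h0 : -1 < Real.cos θ) (h1 : Real.cos θ < 1)
    (hk : k ∈ Ioo 0 (2 * Real.pi)) (hnorm : ‖α‖ ^ 2 + ‖β‖ ^ 2 + ‖γ‖ ^ 2 = 1) (j : Fin 3) :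
    weight θ α β γ k j ≤ 1 := by
  rw [← sum_weight h0 h1 hk hnorm]
  exact Finset.single_le_sum (fun i _ => weight_nonneg θ α β γ k i) (Finset.mem_univ j)

lemma continuousAt_proj_mulVec (h0 : -1 < Real.cos θ) (h1 : Real.cos θ < 1)
    (hk : k ∈ Ioo 0 (2 * Real.pi)) (j i : Fin 3) :
    ContinuousAt (fun k => (proj θ k j *ᵥ ![α, β, γ]) i) k := by
  have h : Continuous fun M : Matrix (Fin 3) (Fin 3) ℂ => (M *ᵥ ![α, β, γ]) i :=
    (continuous_pi_iff.mp (continuous_id.matrix_mulVec continuous_const)) i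
  exact h.continuousAt.comp (continuousAt_proj h0 h1 hk j)

lemma continuousOn_weight (h0 : -1 < Real.cos θ) (h1 : Real.cos θ < 1) (j : Fin 3) :
    ContinuousOn (fun k => weight θ α β γ k j) (Ioo 0 (2 * Real.pi)) := fun k hk => by
  refine ContinuousAt.continuousWithinAt ?_
  unfold weight
  exact tendsto_finsetSum _ fun i _ => (continuousAt_proj_mulVec h0 h1 hk j i).norm.pow 2

/-- A difference quotient with step `ξ / t`. -/
lemma tendsto_mul_phase_sub (h0 : -1 < Real.cos θ) (h1 : Real.cos θ < 1)
    (hk : k ∈ Ioo 0 (2 * Real.pi)) (ξ : ℝ) :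
    Tendsto (fun t : ℕ => (t : ℝ) * (phase θ (k + ξ / t) - phase θ k)) atTop
      (𝓝 (-(ξ * speed θ k))) := by
  -- Differentiating in the step `s = 1 / t` instead of `ξ / t` covers the case `ξ = 0`.
  have hd : HasDerivAt (fun s : ℝ => phase θ (k + s * ξ)) (-(ξ * speed θ k)) 0 := by
    have h : HasDerivAt (fun s : ℝ => k + s * ξ) ξ 0 := by
      simpa using ((hasDerivAt_id (0 : ℝ)).mul_const ξ).const_add k
    have h' : HasDerivAt (phase θ) (-speed θ k) (k + 0 * ξ) := by
      simpa using hasDerivAt_phase h0 h1 hk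
    exact (h'.comp (0 : ℝ) h).congr_deriv (by ring : -speed θ k * ξ = -(ξ * speed θ k))
  have hs : Tendsto (fun t : ℕ => (t : ℝ)⁻¹) atTop (𝓝[≠] 0) := by
    refine tendsto_nhdsWithin_iff.mpr ⟨tendsto_inv_atTop_nhds_zero_nat, ?_⟩
    filter_upwards [eventually_gt_atTop 0] with t ht
    simpa using ht.ne'
  refine ((hasDerivAt_iff_tendsto_slope_zero.mp hd).comp hs).congr fun t => ?_
  simp [div_eq_mul_inv, mul_comm]

/-- The pointwise limit in momentum space. The cross terms between different eigenvalues disappear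
because the projections to them become orthogonal as the momenta merge. -/
lemma tendsto_star_evo_pow (h0 : -1 < Real.cos θ) (h1 : Real.cos θ < 1)
    (hk : k ∈ Ioo 0 (2 * Real.pi)) (ξ : ℝ) :
    Tendsto (fun t : ℕ =>
      star (evo θ (k + ξ / t) ^ t *ᵥ ![α, β, γ]) ⬝ᵥ (evo θ k ^ t *ᵥ ![α, β, γ])) atTop
      (𝓝 (∑ j, cexp (freq j * (ξ * speed θ k) * I) * weight θ α β γ k j)) := by
  have hkt : Tendsto (fun t : ℕ => k + ξ / t) atTop (𝓝 k) := by
    simpa using (tendsto_const_div_atTop_nhds_zero_nat ξ).const_add k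
  have hev : ∀ᶠ t : ℕ in atTop, k + ξ / t ∈ Ioo 0 (2 * Real.pi) :=
    hkt.eventually (isOpen_Ioo.mem_nhds hk)
  have hsum : ∑ j, cexp (freq j * (ξ * speed θ k) * I) * (weight θ α β γ k j : ℂ) =
      ∑ i, ∑ j, if i = j then cexp (freq j * (ξ * speed θ k) * I) * weight θ α β γ k j else 0 := by
    simp
  rw [hsum]
  have hterm : Tendsto (fun t : ℕ => ∑ i, ∑ j,
      (star (cexp (t * (freq i * phase θ (k + ξ / t)) * I)) *
        cexp (t * (freq j * phase θ k) * I)) *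
      (star (proj θ (k + ξ / t) i *ᵥ ![α, β, γ]) ⬝ᵥ (proj θ k j *ᵥ ![α, β, γ]))) atTop
      (𝓝 (∑ i, ∑ j, if i = j then cexp (freq j * (ξ * speed θ k) * I) * weight θ α β γ k j
        else 0)) := by
    refine tendsto_finsetSum _ fun i _ => tendsto_finsetSum _ fun j _ => ?_
    have hin : Tendsto (fun t : ℕ =>
        star (proj θ (k + ξ / t) i *ᵥ ![α, β, γ]) ⬝ᵥ (proj θ k j *ᵥ ![α, β, γ])) atTop
        (𝓝 (if i = j then (weight θ α β γ k j : ℂ) else 0)) := by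
      rw [← star_proj_mulVec h0 h1 hk i j]
      refine tendsto_finsetSum _ fun l _ => Tendsto.mul_const _ ?_
      exact ((continuousAt_proj_mulVec h0 h1 hk i l).tendsto.comp hkt).star
    split_ifs with hij
    · subst hij
      rw [if_pos rfl] at hin
      refine Tendsto.mul ?_ hin
      have h2 := ((tendsto_mul_phase_sub h0 h1 hk ξ).const_mul (-freq i))
      have h3 := (continuous_ofReal.tendsto _).comp h2
      have h4 := (Complex.continuous_exp.tendsto _).comp (h3.mul_const I)
      convert h4 using 2 with t
      · simp only [Function.comp]
        rw [RCLike.star_def, ← Complex.exp_conj, ← Complex.exp_add]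
        congr 1
        simp
        ring
      · push_cast
        ring_nf
    · -- The phases are bounded, and the inner products tend to `0`.
      rw [if_neg hij] at hin
      refine isBoundedUnder_le_mul_tendsto_zero (isBoundedUnder_of ⟨1, fun t => ?_⟩) hin
      have e : ∀ a b : ℝ, ‖cexp (t * (a * b) * I)‖ = 1 := fun a b => by
        exact_mod_cast Complex.norm_exp_ofReal_mul_I (t * (a * b))
      simp only [Function.comp, norm_mul, norm_star, e]
      norm_num
  refine hterm.congr' ?_
  filter_upwards [hev] with t ht
  rw [evo_pow h0 h1 ht, evo_pow h0 h1 hk, Matrix.sum_mulVec, Matrix.sum_mulVec, star_sum,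
    sum_dotProduct]
  refine Finset.sum_congr rfl fun i _ => ?_
  rw [dotProduct_sum]
  refine Finset.sum_congr rfl fun j _ => ?_
  rw [Matrix.smul_mulVec, Matrix.smul_mulVec, star_smul, smul_dotProduct, dotProduct_smul,
    smul_smul, smul_eq_mul]

/-- The characteristic functions of `X_t / t` converge to that of the group velocity, the momentum
being uniformly distributed and the eigenvalue chosen according to `weight`. -/
lemma tendsto_charFun (h0 : -1 < Real.cos θ) (h1 : Real.cos θ < 1)
    (hnorm : ‖α‖ ^ 2 + ‖β‖ ^ 2 + ‖γ‖ ^ 2 = 1) (ξ : ℝ) :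
    Tendsto (fun t : ℕ => charFun ((law θ α β γ t).map fun n : ℤ => (n : ℝ) / t) ξ) atTop
      (𝓝 ((2 * Real.pi : ℂ)⁻¹ * ∫ k in Ioo (0 : ℝ) (2 * Real.pi),
        ∑ j, cexp (freq j * (ξ * speed θ k) * I) * weight θ α β γ k j)) := by
  simp_rw [charFun_law_map hnorm]
  refine Tendsto.const_mul _ ?_
  refine tendsto_integral_of_dominated_convergence (fun _ => 1) (fun t => ?_)
    (integrable_const _) (fun t => ae_of_all _ fun k => ?_)
    ((ae_restrict_iff' measurableSet_Ioo).mpr (ae_of_all _ fun k hk =>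
      tendsto_star_evo_pow h0 h1 hk ξ))
  · refine Continuous.aestronglyMeasurable ?_
    have h := continuous_evo_pow_mulVec θ t ![α, β, γ]
    exact (h.comp (continuous_id.add continuous_const)).star.dotProduct h
  · exact norm_star_dotProduct_le (sum_norm_sq_evo_pow_mulVec hnorm _ t)
      (sum_norm_sq_evo_pow_mulVec hnorm _ t)

/-! ### The Fourier coefficients of the flat band -/

lemma sqrt_two_mul_one_sub_cos_pos (h1 : Real.cos θ < 1) : 0 < √(2 * (1 - Real.cos θ)) :=
  Real.sqrt_pos.mpr (by linarith)

lemma nu_eq (h0 : -1 < Real.cos θ) (h1 : Real.cos θ < 1) :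
    nu θ = (√(2 * (1 - Real.cos θ)) - 2) / (√(2 * (1 - Real.cos θ)) + 2) := by
  have hr := sqrt_two_mul_one_sub_cos_pos h1
  have hr2 : √(2 * (1 - Real.cos θ)) ^ 2 = 2 * (1 - Real.cos θ) := Real.sq_sqrt (by linarith)
  rw [nu, div_eq_div_iff (by linarith) (by linarith)]
  linear_combination 2 * hr2

lemma abs_nu_lt_one (h0 : -1 < Real.cos θ) (h1 : Real.cos θ < 1) : |nu θ| < 1 := by
  have hr := sqrt_two_mul_one_sub_cos_pos h1
  rw [nu_eq h0 h1, abs_lt, lt_div_iff₀ (by linarith), div_lt_iff₀ (by linarith)]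
  constructor <;> linarith

/-- The Poisson kernel: `√(2 (1 - c)) / gap θ k = ∑ₘ ν^|m| e^{ikm}`. -/
lemma hasSum_nu_pow_mul_cexp (h0 : -1 < Real.cos θ) (h1 : Real.cos θ < 1) (k : ℝ) :
    HasSum (fun m : ℤ => ((nu θ ^ m.natAbs : ℝ) : ℂ) * cexp (k * m * I))
      (√(2 * (1 - Real.cos θ)) / gap θ k : ℝ) := by
  have hν := abs_nu_lt_one h0 h1
  have hr := sqrt_two_mul_one_sub_cos_pos h1
  have hr2 : √(2 * (1 - Real.cos θ)) ^ 2 = 2 * (1 - Real.cos θ) := Real.sq_sqrt (by linarith)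
  have hE := cexp_mul_cexp_neg (k * I)
  have hn : ∀ z : ℂ, ‖z‖ = 1 → ‖(nu θ : ℂ) * z‖ < 1 := fun z hz => by
    simpa [hz] using hν
  have n1 : ‖cexp (k * I)‖ = 1 := Complex.norm_exp_ofReal_mul_I k
  have n2 : ‖cexp (-(k * I))‖ = 1 := by
    rw [← neg_mul, ← ofReal_neg]; exact Complex.norm_exp_ofReal_mul_I _
  have s1 := hasSum_geometric_of_norm_lt_one (hn _ n1)
  have s2 := (hasSum_geometric_of_norm_lt_one (hn _ n2)).mul_left ((nu θ : ℂ) * cexp (-(k * I)))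
  have hz : ∀ z : ℂ, ‖z‖ < 1 → 1 - z ≠ 0 := fun z hz h => by
    rw [← sub_eq_zero.mp h] at hz
    simp at hz
  have hz1 := hz _ (hn _ n1)
  have hz2 := hz _ (hn _ n2)
  have hg : (gap θ k : ℂ) ≠ 0 := by exact_mod_cast (gap_pos h1 k).ne'
  convert HasSum.of_nat_of_neg_add_one (f := fun m : ℤ =>
    ((nu θ ^ m.natAbs : ℝ) : ℂ) * cexp (k * m * I)) (hasSum_of_terms_eq s1 fun n => ?_)
    (hasSum_of_terms_eq s2 fun n => ?_) using 1
  · set r := √(2 * (1 - Real.cos θ)) with hrdef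
    have hgk : (2 * gap θ k : ℂ) = 2 + r ^ 2 / 2 + (2 - r ^ 2 / 2) *
        ((cexp (k * I) + cexp (-(k * I))) / 2) := by
      rw [← ofReal_cos_eq]
      norm_cast
      rw [gap, hr2]
      ring
    have hν' : (nu θ : ℂ) = (r - 2) / (r + 2) := by
      rw [nu_eq h0 h1]; push_cast; rfl
    have hr' : (r + 2 : ℂ) ≠ 0 := by exact_mod_cast (by linarith : r + 2 ≠ 0)
    rw [← div_eq_mul_inv, inv_eq_one_div, div_add_div _ _ hz1 hz2, ofReal_div,
      div_eq_div_iff hg (mul_ne_zero hz1 hz2), hν']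
    generalize cexp (k * I) = E at *
    generalize cexp (-(k * I)) = E' at *
    generalize (gap θ k : ℂ) = g at *
    field_simp
    have : g = (2 + r ^ 2 / 2 + (2 - r ^ 2 / 2) * ((E + E') / 2)) / 2 := by
      linear_combination hgk / 2
    rw [this]
    linear_combination ((4 - 2 * r ^ 2 + r ^ 4 / 4 : ℂ) +
      (2 - 2 * r + r ^ 3 / 2 - r ^ 4 / 8) * (E + E')) * hE
  · simp only [Int.natAbs_natCast, mul_pow, ← Complex.exp_nat_mul]
    push_cast
    ring_nf
  · have : (-((n : ℤ) + 1)).natAbs = n + 1 := by omega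
    rw [this]
    simp only [mul_pow, ← Complex.exp_nat_mul]
    rw [mul_mul_mul_comm, ← Complex.exp_add]
    push_cast
    ring_nf

lemma setIntegral_cexp_div_gap (h0 : -1 < Real.cos θ) (h1 : Real.cos θ < 1) (n : ℤ) :
    ∫ k in Ioo (0 : ℝ) (2 * Real.pi), cexp (k * n * I) / gap θ k =
      2 * Real.pi * (nu θ ^ n.natAbs : ℝ) / √(2 * (1 - Real.cos θ)) := by
  have hr := sqrt_two_mul_one_sub_cos_pos h1
  have hr' : (√(2 * (1 - Real.cos θ)) : ℂ) ≠ 0 := by exact_mod_cast hr.ne'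
  have hν := abs_nu_lt_one h0 h1
  have hF : ∀ (m : ℤ) (k : ℝ), ((nu θ ^ m.natAbs : ℝ) : ℂ) * cexp (k * m * I) * cexp (k * n * I) =
      ((nu θ ^ m.natAbs : ℝ) : ℂ) * cexp (k * (m + n : ℤ) * I) := by
    intro m k
    rw [mul_assoc, ← Complex.exp_add]
    push_cast
    ring_nf
  have hs : Summable fun m : ℤ => |nu θ| ^ m.natAbs := by
    have hs1 := (summable_geometric_of_lt_one (abs_nonneg _) hν)
    refine Summable.of_nat_of_neg ?_ ?_ <;> simpa using hs1
  have key := hasSum_integral_of_summable_integral_norm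
    (μ := volume.restrict (Ioo (0 : ℝ) (2 * Real.pi)))
    (F := fun (m : ℤ) (k : ℝ) => ((nu θ ^ m.natAbs : ℝ) : ℂ) * cexp (k * m * I) * cexp (k * n * I))
    (fun m => ?_) ?_
  · have e1 : ∀ k : ℝ, ∑' m : ℤ, ((nu θ ^ m.natAbs : ℝ) : ℂ) * cexp (k * m * I) * cexp (k * n * I) =
        √(2 * (1 - Real.cos θ)) * (cexp (k * n * I) / gap θ k) := fun k => by
      rw [((hasSum_nu_pow_mul_cexp h0 h1 k).mul_right _).tsum_eq]
      push_cast
      ring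
    simp_rw [e1, hF, integral_const_mul, setIntegral_cexp_int] at key
    have e2 := hasSum_single (-n) (f := fun m : ℤ => ((nu θ ^ m.natAbs : ℝ) : ℂ) *
      ((if m + n = 0 then 2 * Real.pi else 0 : ℝ) : ℂ)) fun m hm => by
        rw [if_neg (fun h => hm (by omega))]
        simp
    have := key.unique (by convert e2 using 3)
    simp only [neg_add_cancel, if_true, Int.natAbs_neg] at this
    rw [eq_div_iff hr', mul_comm, this]
    push_cast
    ring
  · refine (Continuous.integrableOn_Icc (a := 0) (b := 2 * Real.pi) ?_).mono_set Ioo_subset_Icc_self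
    fun_prop
  · refine (hs.mul_left (2 * Real.pi)).congr fun m => ?_
    have : ∀ k : ℝ, ‖((nu θ ^ m.natAbs : ℝ) : ℂ) * cexp (k * m * I) * cexp (k * n * I)‖ =
        |nu θ| ^ m.natAbs := fun k => by
      rw [hF, norm_mul, ← ofReal_intCast, ← ofReal_mul, Complex.norm_exp_ofReal_mul_I]
      simp
    simp_rw [this]
    rw [setIntegral_const, Real.volume_real_Ioo_of_le (by positivity)]
    simp

lemma coeff_eq (θ : ℝ) : ∃ σ c : ℝ, 2 * (σ : ℂ) ^ 2 = 1 - c ^ 2 ∧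
    c = Real.cos θ ∧ σ = Real.sin θ / √2 ∧
    coin θ = !![-(1 + c : ℂ) / 2, σ, (1 - c) / 2; (σ : ℂ), c, σ; (1 - c : ℂ) / 2, σ, -(1 + c) / 2] ∧
    (∀ α β, coeffA θ α β = 2 * (1 - c) * α + 2 * σ * β) ∧
    (∀ β γ, coeffB θ β γ = 2 * σ * β + 2 * (1 - c) * γ) := by
  obtain ⟨σ, c, h, hc, hσ, hC⟩ := coin_eq θ
  have e : √2 * Real.sin θ = 2 * σ := by
    rw [hσ]
    have := Real.sq_sqrt (show (0 : ℝ) ≤ 2 by norm_num)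
    field_simp
    linear_combination Real.sin θ * this
  refine ⟨σ, c, h, hc, hσ, hC, fun α β => ?_, fun β γ => ?_⟩ <;>
    simp only [coeffA, coeffB, e, ← hc] <;> push_cast <;> ring

/-- The component of the initial state in the flat band. -/
lemma flatProj_mulVec (h1 : Real.cos θ < 1) (α β γ : ℂ) (k : ℝ) :
    flatProj θ k *ᵥ ![α, β, γ] = (gap θ k : ℂ)⁻¹ •
      ![(coeffA θ α β + cexp (k * I) * coeffB θ β γ) / 4,
        (Real.sin θ / √2 / (4 * (1 - Real.cos θ)) : ℝ) *
          ((1 + cexp (-(k * I))) * (coeffA θ α β + cexp (k * I) * coeffB θ β γ)),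
        (cexp (-(k * I)) * coeffA θ α β + coeffB θ β γ) / 4] := by
  obtain ⟨σ, c, h, hc, hσ, hC, hA, hB⟩ := coeff_eq θ
  have hE := cexp_mul_cexp_neg (k * I)
  have hg : (2 * (1 - gap θ k : ℂ)) =
      c - 1 - (1 + c) * (cexp (k * I) + cexp (-(k * I))) / 2 := by
    rw [gap, ← hc]
    push_cast
    rw [← ofReal_cos, ofReal_cos_eq]
    ring
  have hc1 : (1 - c : ℂ) ≠ 0 := by
    rw [← hc] at h1
    exact_mod_cast (sub_pos.mpr h1).ne'
  rw [flatProj, hg, evo_eq, hC, hA, hB, mul_inv, mul_comm, ← smul_smul, Matrix.smul_mulVec]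
  congr 1
  rw [← hσ, ← hc, Matrix.smul_mulVec]
  ext i
  match i with
  | 0 =>
    simp [Matrix.mulVec, dotProduct, Fin.sum_univ_three, star_cexp_mul_I, star_cexp_neg_mul_I,
      map_ofNat]
    grind
  | 1 =>
    simp [Matrix.mulVec, dotProduct, Fin.sum_univ_three, star_cexp_mul_I, star_cexp_neg_mul_I]
    field_simp
    grind
  | 2 =>
    simp [Matrix.mulVec, dotProduct, Fin.sum_univ_three, star_cexp_mul_I, star_cexp_neg_mul_I,
      map_ofNat]
    grind

/-! ### Localization -/

/-- The Riemann–Lebesgue lemma for a phase function `φ` without critical points, by the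
substitution `y = φ k`. -/
lemma tendsto_setIntegral_cexp_mul {s : Set ℝ} (hs : MeasurableSet s) {φ φ' : ℝ → ℝ}
    (hd : ∀ k ∈ s, HasDerivAt φ (φ' k) k) (hinj : InjOn φ s) (h0 : ∀ k ∈ s, φ' k ≠ 0) (g : ℝ → ℂ) :
    Tendsto (fun w : ℝ => ∫ k in s, cexp (w * φ k * I) * g k) (cocompact ℝ) (𝓝 0) := by
  have hms : MeasurableSet (φ '' s) :=
    hs.image_of_continuousOn_injOn (fun k hk => (hd k hk).continuousAt.continuousWithinAt) hinj
  -- The integrand after the substitution; it need not be integrable, as both sides of the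
  -- change of variables are then `0`.
  set G : ℝ → ℂ := fun y => (|φ' (Function.invFunOn φ s y)|⁻¹ : ℝ) * g (Function.invFunOn φ s y)
  have hRL := Real.tendsto_integral_exp_smul_cocompact ((φ '' s).indicator G)
  have hc : Tendsto (fun w : ℝ => -(2 * Real.pi)⁻¹ * w) (cocompact ℝ) (cocompact ℝ) :=
    (Homeomorph.mulLeft₀ (-(2 * Real.pi)⁻¹) (by simp)).isClosedEmbedding.tendsto_cocompact
  refine (hRL.comp hc).congr fun w => ?_
  have hpi : (Real.pi : ℂ) ≠ 0 := by exact_mod_cast Real.pi_ne_zero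
  have e1 : ∀ y, Real.fourierChar (-(y * (-(2 * Real.pi)⁻¹ * w))) • (φ '' s).indicator G y =
      (φ '' s).indicator (fun y => cexp (w * y * I) * G y) y := by
    intro y
    by_cases hy : y ∈ φ '' s
    · rw [indicator_of_mem hy, indicator_of_mem hy, Circle.smul_def, Real.fourierChar_apply,
        smul_eq_mul]
      congr 2
      push_cast
      field_simp
    · rw [indicator_of_notMem hy, indicator_of_notMem hy, smul_zero]
  simp only [Function.comp, e1]
  rw [integral_indicator hms, integral_image_eq_integral_abs_deriv_smul hs
    (fun k hk => (hd k hk).hasDerivWithinAt) hinj]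
  refine setIntegral_congr_fun hs fun k hk => ?_
  have hk' : ((|φ' k| : ℝ) : ℂ) ≠ 0 := by exact_mod_cast (abs_pos.mpr (h0 k hk)).ne'
  simp only [G, hinj.leftInvOn_invFunOn hk, real_smul, ofReal_inv]
  field_simp

lemma Ioo_eq_union_Ioo_pi : Ioc 0 Real.pi ∪ Ioo Real.pi (2 * Real.pi) = Ioo 0 (2 * Real.pi) :=
  Ioc_union_Ioo_eq_Ioo Real.pi_pos.le (by linarith [Real.pi_pos])

/-- The phase function has the single critical point `π` in `(0, 2π)`. -/
lemma tendsto_setIntegral_cexp_phase_mul (h0 : -1 < Real.cos θ) (h1 : Real.cos θ < 1) (g : ℝ → ℂ)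
    (hg : IntegrableOn g (Ioo 0 (2 * Real.pi))) {ω : ℝ} (hω : ω ≠ 0) :
    Tendsto (fun t : ℕ => ∫ k in Ioo 0 (2 * Real.pi), cexp (t * (ω * phase θ k) * I) * g k) atTop
      (𝓝 0) := by
  have hpi := Real.pi_pos
  have hsq : ∀ k, 0 < √(1 + Real.cos θ) / √(gap θ k) := fun k =>
    div_pos (Real.sqrt_pos.mpr (by linarith)) (Real.sqrt_pos.mpr (gap_pos h1 k))
  have hsp : ∀ k, speed θ k = √(1 + Real.cos θ) / √(gap θ k) * Real.cos (k / 2) := fun k => by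
    rw [speed]; ring
  have hw : Tendsto (fun t : ℕ => (t : ℝ) * ω) atTop (cocompact ℝ) := by
    have : Tendsto (fun w : ℝ => w * ω) (cocompact ℝ) (cocompact ℝ) :=
      (Homeomorph.mulRight₀ ω hω).isClosedEmbedding.tendsto_cocompact
    exact this.comp (tendsto_natCast_atTop_atTop.mono_right atTop_le_cocompact)
  have hlow : ∀ k ∈ Ioo 0 Real.pi, 0 < speed θ k := fun k hk => by
    rw [hsp]
    exact mul_pos (hsq k) (Real.cos_pos_of_mem_Ioo ⟨by linarith [hk.1], by linarith [hk.2]⟩)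
  have hhigh : ∀ k ∈ Ioo Real.pi (2 * Real.pi), speed θ k < 0 := fun k hk => by
    rw [hsp]
    exact mul_neg_of_pos_of_neg (hsq k) (Real.cos_neg_of_pi_div_two_lt_of_lt (by linarith [hk.1])
      (by linarith [hk.2]))
  have hd : ∀ k ∈ Ioo 0 (2 * Real.pi), HasDerivAt (phase θ) (-speed θ k) k := fun k hk =>
    hasDerivAt_phase h0 h1 hk
  have hsub1 : Ioo 0 Real.pi ⊆ Ioo 0 (2 * Real.pi) := Ioo_subset_Ioo_right (by linarith)
  have hsub2 : Ioo Real.pi (2 * Real.pi) ⊆ Ioo 0 (2 * Real.pi) := Ioo_subset_Ioo_left hpi.le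
  have hinj1 : InjOn (phase θ) (Ioo 0 Real.pi) := by
    refine (strictAntiOn_of_deriv_neg (convex_Ioo _ _) (continuous_phase θ).continuousOn
      fun k hk => ?_).injOn
    rw [interior_Ioo] at hk
    rw [(hd k (hsub1 hk)).deriv]
    linarith [hlow k hk]
  have hinj2 : InjOn (phase θ) (Ioo Real.pi (2 * Real.pi)) := by
    refine (strictMonoOn_of_deriv_pos (convex_Ioo _ _) (continuous_phase θ).continuousOn
      fun k hk => ?_).injOn
    rw [interior_Ioo] at hk
    rw [(hd k (hsub2 hk)).deriv]
    linarith [hhigh k hk]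
  -- On each side of `π` the phase function is strictly monotone without critical points.
  have l1 := (tendsto_setIntegral_cexp_mul measurableSet_Ioo (fun k hk => hd k (hsub1 hk)) hinj1
    (fun k hk => by linarith [hlow k hk] : ∀ k ∈ _, _) g).comp hw
  have l2 := (tendsto_setIntegral_cexp_mul measurableSet_Ioo (fun k hk => hd k (hsub2 hk)) hinj2
    (fun k hk => by linarith [hhigh k hk] : ∀ k ∈ _, _) g).comp hw
  have l := l1.add l2
  rw [add_zero] at l
  refine l.congr fun t => ?_
  have hi : IntegrableOn (fun k => cexp (t * (ω * phase θ k) * I) * g k)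
      (Ioo 0 (2 * Real.pi)) := by
    refine hg.bdd_mul (c := 1) ?_ (ae_of_all _ fun k => ?_)
    · refine Continuous.aestronglyMeasurable ?_
      have := continuous_ofReal.comp (continuous_phase θ)
      exact Complex.continuous_exp.comp
        ((continuous_const.mul (continuous_const.mul this)).mul continuous_const)
    · have := Complex.norm_exp_ofReal_mul_I (t * (ω * phase θ k))
      push_cast at this
      exact this.le
  rw [← Ioo_eq_union_Ioo_pi] at hi ⊢
  rw [setIntegral_union (Set.disjoint_left.mpr fun x hx hx' => absurd hx.2 (not_le.mpr hx'.1))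
    measurableSet_Ioo (hi.mono_set subset_union_left) (hi.mono_set subset_union_right),
    integral_Ioc_eq_integral_Ioo]
  simp only [Function.comp, ofReal_mul, mul_assoc]
  rfl

lemma integrableOn_cexp_mul_proj (h0 : -1 < Real.cos θ) (h1 : Real.cos θ < 1)
    (hnorm : ‖α‖ ^ 2 + ‖β‖ ^ 2 + ‖γ‖ ^ 2 = 1) (x : ℤ) (i j : Fin 3) :
    IntegrableOn (fun k : ℝ => cexp (k * x * I) * (proj θ k i *ᵥ ![α, β, γ]) j)
      (Ioo 0 (2 * Real.pi)) := by
  refine IntegrableOn.of_bound measure_Ioo_lt_top ?_ 1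
    ((ae_restrict_iff' measurableSet_Ioo).mpr (ae_of_all _ fun k hk => ?_))
  · refine ContinuousOn.aestronglyMeasurable (fun k hk => ?_) measurableSet_Ioo
    refine (ContinuousAt.mul ?_ (continuousAt_proj_mulVec h0 h1 hk i j)).continuousWithinAt
    fun_prop
  · rw [norm_mul, ← ofReal_intCast, ← ofReal_mul, Complex.norm_exp_ofReal_mul_I, one_mul]
    have h : ‖(proj θ k i *ᵥ ![α, β, γ]) j‖ ^ 2 ≤ 1 :=
      (Finset.single_le_sum (f := fun j => ‖(proj θ k i *ᵥ ![α, β, γ]) j‖ ^ 2)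
        (fun _ _ => by positivity) (Finset.mem_univ j)).trans (weight_le_one h0 h1 hk hnorm i)
    exact (sq_le_one_iff₀ (norm_nonneg _)).mp h

/-- The part of the walk in the flat band, which does not depend on the time. -/
def flatAmplitude (θ : ℝ) (α β γ : ℂ) (x : ℤ) : Fin 3 → ℂ :=
  let p : ℤ → ℂ := fun y => ((nu θ ^ y.natAbs : ℝ) : ℂ)
  let A := coeffA θ α β
  let B := coeffB θ β γ
  (√(2 * (1 - Real.cos θ)) : ℂ)⁻¹ • ![(4 : ℂ)⁻¹ * (B * p (x + 1) + A * p x),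
    (Real.sin θ / √2 / (4 * (1 - Real.cos θ)) : ℝ) * (B * p (x + 1) + (A + B) * p x + A * p (x - 1)),
    (4 : ℂ)⁻¹ * (B * p x + A * p (x - 1))]

lemma integrableOn_cexp_div_gap (h1 : Real.cos θ < 1) (n : ℤ) (u : ℂ) :
    IntegrableOn (fun k : ℝ => u * (cexp (k * n * I) / gap θ k)) (Ioo 0 (2 * Real.pi)) := by
  refine (Continuous.integrableOn_Icc (a := 0) (b := 2 * Real.pi) ?_).mono_set Ioo_subset_Icc_self
  have h : Continuous fun k : ℝ => cexp (k * n * I) := by fun_prop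
  exact continuous_const.mul (h.div (continuous_ofReal.comp (continuous_gap θ))
    fun k => by exact_mod_cast (gap_pos h1 k).ne')

lemma setIntegral_trigonometric_div_gap (h0 : -1 < Real.cos θ) (h1 : Real.cos θ < 1)
    (x : ℤ) {a b c : ℂ} {f : ℝ → ℂ}
    (h : ∀ k, f k = (gap θ k : ℂ)⁻¹ * (a * cexp (k * I) + b + c * cexp (-(k * I)))) :
    ∫ k in Ioo (0 : ℝ) (2 * Real.pi), cexp (k * x * I) * f k = 2 * Real.pi *
      ((√(2 * (1 - Real.cos θ)) : ℂ)⁻¹ * (a * (nu θ ^ (x + 1).natAbs : ℝ) +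
        b * (nu θ ^ x.natAbs : ℝ) + c * (nu θ ^ (x - 1).natAbs : ℝ))) := by
  have e : ∀ k : ℝ, cexp (k * x * I) * f k =
      a * (cexp (k * (x + 1 : ℤ) * I) / gap θ k) + (b * (cexp (k * x * I) / gap θ k) +
        c * (cexp (k * (x - 1 : ℤ) * I) / gap θ k)) := by
    intro k
    have e1 : cexp (k * (x + 1 : ℤ) * I) = cexp (k * x * I) * cexp (k * I) := by
      rw [← Complex.exp_add]; push_cast; ring_nf
    have e2 : cexp (k * (x - 1 : ℤ) * I) = cexp (k * x * I) * cexp (-(k * I)) := by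
      rw [← Complex.exp_add]; push_cast; ring_nf
    rw [h, e1, e2]
    ring
  have hi := integrableOn_cexp_div_gap h1
  simp_rw [e]
  refine (integral_add (hi _ _) ((hi _ _).add (hi _ _))).trans ?_
  refine (congrArg (_ + ·) (integral_add (hi _ _) (hi _ _))).trans ?_
  simp_rw [integral_const_mul, setIntegral_cexp_div_gap h0 h1]
  ring

/-- Fourier inversion for the part of the walk in the flat band. -/
lemma setIntegral_flatProj (h0 : -1 < Real.cos θ) (h1 : Real.cos θ < 1) (α β γ : ℂ)
    (x : ℤ) (j : Fin 3) :
    ∫ k in Ioo (0 : ℝ) (2 * Real.pi), cexp (k * x * I) * (flatProj θ k *ᵥ ![α, β, γ]) j =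
      2 * Real.pi * flatAmplitude θ α β γ x j := by
  have hE := fun k : ℝ => cexp_mul_cexp_neg (k * I)
  match j with
  | 0 =>
    rw [setIntegral_trigonometric_div_gap h0 h1 x (a := coeffB θ β γ / 4) (b := coeffA θ α β / 4)
      (c := 0) fun k => by rw [flatProj_mulVec h1]; simp; left; ring]
    simp [flatAmplitude]
    ring_nf
    simp
  | 1 =>
    set κ : ℂ := ((Real.sin θ / √2 / (4 * (1 - Real.cos θ)) : ℝ) : ℂ) with hκ
    rw [setIntegral_trigonometric_div_gap h0 h1 x (a := κ * coeffB θ β γ)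
      (b := κ * (coeffA θ α β + coeffB θ β γ)) (c := κ * coeffA θ α β) fun k => by
        rw [flatProj_mulVec h1, Pi.smul_apply, smul_eq_mul]
        congr 1
        change κ * _ = _
        linear_combination κ * coeffB θ β γ * hE k]
    simp only [flatAmplitude, ← hκ, Pi.smul_apply, smul_eq_mul]
    congr 2
    change _ = κ * _
    ring
  | 2 =>
    rw [setIntegral_trigonometric_div_gap h0 h1 x (a := 0) (b := coeffB θ β γ / 4)
      (c := coeffA θ α β / 4) fun k => by rw [flatProj_mulVec h1]; simp; left; ring]
    simp [flatAmplitude]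
    ring_nf
    simp

/-- The amplitude converges to its part in the flat band. -/
lemma tendsto_amplitude (h0 : -1 < Real.cos θ) (h1 : Real.cos θ < 1)
    (hnorm : ‖α‖ ^ 2 + ‖β‖ ^ 2 + ‖γ‖ ^ 2 = 1) (x : ℤ) (j : Fin 3) :
    Tendsto (fun t : ℕ => amplitude θ α β γ t x j) atTop (𝓝 (flatAmplitude θ α β γ x j)) := by
  have hpi : (2 * Real.pi : ℂ) ≠ 0 := by exact_mod_cast (by positivity : 2 * Real.pi ≠ 0)
  rw [← inv_mul_cancel_left₀ hpi (flatAmplitude θ α β γ x j), ← setIntegral_flatProj h0 h1]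
  simp_rw [amplitude_eq_integral]
  refine Tendsto.const_mul _ ?_
  have hi := integrableOn_cexp_mul_proj h0 h1 hnorm x
  have l1 := tendsto_setIntegral_cexp_phase_mul h0 h1 _ (hi 1 j) one_ne_zero
  have l2 := tendsto_setIntegral_cexp_phase_mul h0 h1 _ (hi 2 j) (neg_ne_zero.mpr one_ne_zero)
  have l := (l1.add l2).const_add
    (∫ k in Ioo (0 : ℝ) (2 * Real.pi), cexp (k * x * I) * (flatProj θ k *ᵥ ![α, β, γ]) j)
  rw [add_zero, add_zero] at l
  refine l.congr fun t => ?_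
  have hb : ∀ (ω : ℝ) (i : Fin 3), IntegrableOn (fun k => cexp (t * (ω * phase θ k) * I) *
      (cexp (k * x * I) * (proj θ k i *ᵥ ![α, β, γ]) j)) (Ioo 0 (2 * Real.pi)) := fun ω i => by
    refine (hi i j).bdd_mul (c := 1) ?_ (ae_of_all _ fun k => ?_)
    · refine Continuous.aestronglyMeasurable ?_
      have := continuous_ofReal.comp (continuous_phase θ)
      exact Complex.continuous_exp.comp
        ((continuous_const.mul (continuous_const.mul this)).mul continuous_const)
    · have := Complex.norm_exp_ofReal_mul_I (t * (ω * phase θ k))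
      push_cast at this
      exact this.le
  rw [← integral_add (hb 1 1) (hb (-1) 2)]
  refine (integral_add (hi 0 j) ((hb 1 1).add (hb (-1) 2))).symm.trans ?_
  refine setIntegral_congr_fun measurableSet_Ioo fun k hk => ?_
  simp only [evo_pow h0 h1 hk, Fin.sum_univ_three, Matrix.add_mulVec, Matrix.smul_mulVec,
    Pi.add_apply, Pi.smul_apply, smul_eq_mul, freq]
  simp
  ring

lemma sum_norm_sq_flatAmplitude (h1 : Real.cos θ < 1) (α β γ : ℂ) (x : ℤ) :
    ∑ j, ‖flatAmplitude θ α β γ x j‖ ^ 2 = limitMass θ α β γ x := by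
  have hr2 : √(2 * (1 - Real.cos θ)) ^ 2 = 2 * (1 - Real.cos θ) := Real.sq_sqrt (by linarith)
  have h1c : (1 - Real.cos θ) ≠ 0 := by linarith
  have hs2 : (Real.sin θ / √2 / (4 * (1 - Real.cos θ))) ^ 2 =
      (1 + Real.cos θ) / (32 * (1 - Real.cos θ)) := by
    rw [div_pow, div_pow, Real.sq_sqrt (by norm_num), Real.sin_sq]
    field_simp
    ring
  simp only [flatAmplitude, limitMass, Fin.sum_univ_three, Pi.smul_apply, smul_eq_mul,
    Matrix.cons_val, norm_mul, norm_inv, norm_real, mul_pow, inv_pow, Real.norm_eq_abs, sq_abs,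
    hr2, hs2, RCLike.norm_ofNat]
  field_simp
  ring

lemma tendsto_prob (h0 : -1 < Real.cos θ) (h1 : Real.cos θ < 1)
    (hnorm : ‖α‖ ^ 2 + ‖β‖ ^ 2 + ‖γ‖ ^ 2 = 1) (x : ℤ) :
    Tendsto (fun t : ℕ => prob θ α β γ t x) atTop (𝓝 (limitMass θ α β γ x)) := by
  rw [← sum_norm_sq_flatAmplitude h1]
  exact tendsto_finsetSum _ fun j _ => (tendsto_amplitude h0 h1 hnorm x j).norm.pow 2

lemma Delta_eq (h1 : Real.cos θ < 1) (α β γ : ℂ) :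
    Delta θ α β γ = (8 * (1 - Real.cos θ) * √(2 * (1 - Real.cos θ)))⁻¹ *
      (‖coeffA θ α β‖ ^ 2 + ‖coeffB θ β γ‖ ^ 2 +
        2 * nu θ * (coeffA θ α β * star (coeffB θ β γ)).re) := by
  have h : 8 * √2 * (1 - Real.cos θ) ^ (3 / 2 : ℝ) =
      8 * (1 - Real.cos θ) * √(2 * (1 - Real.cos θ)) := by
    rw [Real.sqrt_mul (by norm_num), show (3 / 2 : ℝ) = 1 + 1 / 2 by norm_num,
      Real.rpow_add (by linarith), Real.rpow_one, ← Real.sqrt_eq_rpow]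
    ring
  simp only [Delta, h, one_div]

/-- The mean weight of the flat band over the momenta is the weight of the atom. -/
lemma setIntegral_weight_zero (h0 : -1 < Real.cos θ) (h1 : Real.cos θ < 1)
    (hnorm : ‖α‖ ^ 2 + ‖β‖ ^ 2 + ‖γ‖ ^ 2 = 1) :
    ∫ k in Ioo (0 : ℝ) (2 * Real.pi), (weight θ α β γ k 0 : ℂ) =
      2 * Real.pi * Delta θ α β γ := by
  have hr := sqrt_two_mul_one_sub_cos_pos h1
  have hi := fun j => integrableOn_cexp_mul_proj h0 h1 hnorm 0 0 j
  have e : ∫ k in Ioo (0 : ℝ) (2 * Real.pi), (weight θ α β γ k 0 : ℂ) =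
      ∫ k in Ioo (0 : ℝ) (2 * Real.pi), ∑ j, star (![α, β, γ] j) *
        (cexp (k * (0 : ℤ) * I) * (proj θ k 0 *ᵥ ![α, β, γ]) j) := by
    refine setIntegral_congr_fun measurableSet_Ioo fun k hk => ?_
    simp only [weight_eq h0 h1 hk, dotProduct]
    simp
  rw [e, integral_finsetSum _ fun j _ => (hi j).const_mul _]
  simp_rw [integral_const_mul]
  have hj : ∀ j, ∫ k in Ioo (0 : ℝ) (2 * Real.pi),
      cexp (k * (0 : ℤ) * I) * (proj θ k 0 *ᵥ ![α, β, γ]) j =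
      2 * Real.pi * flatAmplitude θ α β γ 0 j := setIntegral_flatProj h0 h1 α β γ 0
  simp_rw [hj]
  obtain ⟨σ, c, h, hc, hσ, -, hA, hB⟩ := coeff_eq θ
  have hc1 : (1 - c : ℂ) ≠ 0 := by
    rw [← hc] at h1
    exact_mod_cast (sub_pos.mpr h1).ne'
  have hD : (Delta θ α β γ : ℂ) = (8 * (1 - c) * √(2 * (1 - Real.cos θ)))⁻¹ *
      (star (coeffA θ α β) * (coeffA θ α β + nu θ * coeffB θ β γ) +
        star (coeffB θ β γ) * (coeffB θ β γ + nu θ * coeffA θ α β)) := by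
    have hre : ((2 * (coeffA θ α β * star (coeffB θ β γ)).re : ℝ) : ℂ) =
        coeffA θ α β * star (coeffB θ β γ) + star (coeffA θ α β) * coeffB θ β γ := by
      rw [← Complex.add_conj]
      simp
    rw [Delta_eq h1]
    push_cast at hre ⊢
    rw [← ofReal_cos, ← hc, ← Complex.conj_mul', ← Complex.conj_mul']
    simp only [RCLike.star_def] at hre ⊢
    linear_combination (8 * (1 - c) * (√(2 * (1 - c)) : ℂ))⁻¹ * nu θ * hre
  have hr' : (√(2 * (1 - Real.cos θ)) : ℂ) ≠ 0 := by exact_mod_cast hr.ne'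
  rw [hD]
  simp only [flatAmplitude, Fin.sum_univ_three, ← hσ, hA, hB, Pi.smul_apply, smul_eq_mul,
    Matrix.cons_val, RCLike.star_def, map_add, map_mul, map_sub, map_one, conj_ofReal, map_ofNat]
  simp [← hc, -ofReal_cos]
  field_simp
  ring

/-- The geometric series `∑ₓ ν^|x| ν^|x + n|` over the integers, for `n = 0, 1, 2`. -/
lemma hasSum_pow_natAbs {ν : ℝ} (hν : |ν| < 1) :
    HasSum (fun x : ℤ => ν ^ x.natAbs * ν ^ x.natAbs) ((1 + ν ^ 2) / (1 - ν ^ 2)) ∧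
    HasSum (fun x : ℤ => ν ^ x.natAbs * ν ^ (x + 1).natAbs) (2 * ν / (1 - ν ^ 2)) ∧
    HasSum (fun x : ℤ => ν ^ x.natAbs * ν ^ (x + 2).natAbs)
      (2 * ν ^ 2 / (1 - ν ^ 2) + ν ^ 2) := by
  have hν2 : ν ^ 2 < 1 := (sq_lt_one_iff_abs_lt_one ν).mpr hν
  have hne : 1 - ν ^ 2 ≠ 0 := by linarith
  have hg := hasSum_geometric_of_lt_one (sq_nonneg ν) hν2
  have hn : ∀ n : ℕ, (-((n : ℤ) + 1)).natAbs = n + 1 := fun n => by omega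
  refine ⟨?_, ?_, ?_⟩
  · have := HasSum.of_nat_of_neg_add_one (f := fun x : ℤ => ν ^ x.natAbs * ν ^ x.natAbs)
      (hasSum_of_terms_eq hg fun n => ?_) (hasSum_of_terms_eq (hg.mul_left (ν ^ 2)) fun n => ?_)
    · convert this using 1
      field_simp
    · rw [Int.natAbs_natCast]
      ring
    · rw [hn]
      ring
  · have := HasSum.of_nat_of_neg_add_one (f := fun x : ℤ => ν ^ x.natAbs * ν ^ (x + 1).natAbs)
      (hasSum_of_terms_eq (hg.mul_left ν) fun n => ?_)
      (hasSum_of_terms_eq (hg.mul_left ν) fun n => ?_)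
    · convert this using 1
      field_simp
      ring
    · rw [Int.natAbs_natCast, show ((n : ℤ) + 1).natAbs = n + 1 by omega]
      ring
    · rw [hn, show (-((n : ℤ) + 1) + 1).natAbs = n by omega]
      ring
  · have h' : HasSum (fun n : ℕ => ν ^ (-((n : ℤ) + 1)).natAbs * ν ^ (-((n : ℤ) + 1) + 2).natAbs)
        (ν ^ 2 * (1 - ν ^ 2)⁻¹ + ν ^ 2) := by
      refine (hasSum_nat_add_iff' 1).mp ?_
      simp only [Finset.range_one, Finset.sum_singleton]
      have e : ν ^ 2 * (1 - ν ^ 2)⁻¹ + ν ^ 2 - ν ^ (-(((0 : ℕ) : ℤ) + 1)).natAbs *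
          ν ^ (-(((0 : ℕ) : ℤ) + 1) + 2).natAbs = ν ^ 2 * (1 - ν ^ 2)⁻¹ := by
        norm_num
        ring
      rw [e]
      refine hasSum_of_terms_eq (hg.mul_left (ν ^ 2)) fun n => ?_
      rw [hn, show (-(((n + 1 : ℕ) : ℤ) + 1) + 2).natAbs = n by omega]
      ring
    have := HasSum.of_nat_of_neg_add_one (f := fun x : ℤ => ν ^ x.natAbs * ν ^ (x + 2).natAbs)
      (hasSum_of_terms_eq (hg.mul_left (ν ^ 2)) fun n => ?_) h'
    · convert this using 1
      field_simp
      ring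
    · rw [Int.natAbs_natCast, show ((n : ℤ) + 2).natAbs = n + 2 by omega]
      ring

lemma hasSum_limitMass (h0 : -1 < Real.cos θ) (h1 : Real.cos θ < 1) (α β γ : ℂ) :
    HasSum (limitMass θ α β γ) (Delta θ α β γ) := by
  have hr := sqrt_two_mul_one_sub_cos_pos h1
  have hr2 : √(2 * (1 - Real.cos θ)) ^ 2 = 2 * (1 - Real.cos θ) := Real.sq_sqrt (by linarith)
  have hν := nu_eq h0 h1
  obtain ⟨S0, S1, S2⟩ := hasSum_pow_natAbs (abs_nu_lt_one h0 h1)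
  have T0 := (Equiv.addRight (1 : ℤ)).hasSum_iff.mpr S0
  have T0' := (Equiv.addRight (-1 : ℤ)).hasSum_iff.mpr S0
  have T1 := (Equiv.addRight (-1 : ℤ)).hasSum_iff.mpr S1
  have T2 := (Equiv.addRight (-1 : ℤ)).hasSum_iff.mpr S2
  set A := coeffA θ α β with hA
  set B := coeffB θ β γ with hB
  set a := A.re ^ 2 + A.im ^ 2 with ha
  set b := B.re ^ 2 + B.im ^ 2 with hb
  set m := A.re * B.re + A.im * B.im with hm
  -- Expanding the three squares of `limitMass` gives a combination of six shifted series, with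
  -- `a = |A|²`, `b = |B|²` and `m = Re (A B̄)`.
  have hsum := (((((((S0.mul_left (2 * (1 - Real.cos θ) * (a + b) + (1 + Real.cos θ) *
    (a + b + 2 * m))).add
    (T0.mul_left (2 * (1 - Real.cos θ) * b + (1 + Real.cos θ) * b))).add
    (T0'.mul_left (2 * (1 - Real.cos θ) * a + (1 + Real.cos θ) * a))).add
    (S1.mul_left (4 * (1 - Real.cos θ) * m + 2 * (1 + Real.cos θ) * (m + b)))).add
    (T1.mul_left (4 * (1 - Real.cos θ) * m + 2 * (1 + Real.cos θ) * (m + a)))).add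
    (T2.mul_left (2 * (1 + Real.cos θ) * m)))).mul_left (1 / (64 * (1 - Real.cos θ) ^ 2))
  have hΔ : Delta θ α β γ = (8 * (1 - Real.cos θ) * √(2 * (1 - Real.cos θ)))⁻¹ *
      (a + b + 2 * nu θ * m) := by
    rw [Delta_eq h1, ← hA, ← hB, Complex.sq_norm, Complex.sq_norm, Complex.normSq_apply,
      Complex.normSq_apply, RCLike.star_def, Complex.mul_re, Complex.conj_re, Complex.conj_im]
    ring
  have hcast : ∀ v, v = Delta θ α β γ → HasSum (limitMass θ α β γ) v →
      HasSum (limitMass θ α β γ) (Delta θ α β γ) := fun v hv h => hv ▸ h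
  refine hcast _ ?_ (hasSum_of_terms_eq hsum fun x => ?_)
  rotate_left
  · simp only [limitMass, ← hA, ← hB, Complex.sq_norm, Complex.normSq_apply, Complex.add_re,
      Complex.add_im, Complex.mul_re, Complex.mul_im, ofReal_re, ofReal_im, Function.comp,
      Equiv.coe_addRight, ← sub_eq_add_neg, sub_add_cancel, ha, hb, hm,
      show x - 1 + 2 = x + 1 by ring]
    ring
  · set r := √(2 * (1 - Real.cos θ))
    have hc : Real.cos θ = 1 - r ^ 2 / 2 := by linarith
    have hr' : r + 2 ≠ 0 := by linarith
    have hne : 1 - nu θ ^ 2 = 8 * r / (r + 2) ^ 2 := by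
      rw [hν]
      field_simp
      ring
    rw [hΔ, hne, hν, hc]
    field_simp
    ring

/-! ### The group velocity as a coordinate on the momenta -/

/-- The inverse function of the group velocity `speed θ` on `(0, 2π)`. -/
def momentum (θ x : ℝ) : ℝ :=
  2 * Real.arccos (√(1 - Real.cos θ) / √(1 + Real.cos θ) * (x / √(1 - x ^ 2)))

lemma two_mul_sq_lt_of_mem_window (hx : x ∈ window θ) : 2 * x ^ 2 < 1 + Real.cos θ := by
  have h : x ^ 2 < (1 + Real.cos θ) / 2 := by
    have := (Real.lt_sqrt (abs_nonneg x)).mp (abs_lt.mpr hx)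
    rwa [sq_abs] at this
  linarith

lemma one_sub_sq_pos_of_mem_window (h1 : Real.cos θ < 1) (hx : x ∈ window θ) : 0 < 1 - x ^ 2 := by
  linarith [two_mul_sq_lt_of_mem_window hx]

/-- The square of the cosine of half the momentum with group velocity `x`, subtracted from `1`. -/
lemma one_sub_sq_cos_half_momentum (h0 : -1 < Real.cos θ) (h1 : Real.cos θ < 1)
    (hx : x ∈ window θ) :
    1 - (√(1 - Real.cos θ) / √(1 + Real.cos θ) * (x / √(1 - x ^ 2))) ^ 2 =
      (1 + Real.cos θ - 2 * x ^ 2) / ((1 + Real.cos θ) * (1 - x ^ 2)) := by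
  have hx1 := one_sub_sq_pos_of_mem_window h1 hx
  have hc : 1 + Real.cos θ ≠ 0 := by linarith
  rw [mul_pow, div_pow, div_pow, Real.sq_sqrt (by linarith), Real.sq_sqrt (by linarith),
    Real.sq_sqrt hx1.le]
  field_simp
  ring

lemma cos_half_momentum_mem (h0 : -1 < Real.cos θ) (h1 : Real.cos θ < 1) (hx : x ∈ window θ) :
    √(1 - Real.cos θ) / √(1 + Real.cos θ) * (x / √(1 - x ^ 2)) ∈ Ioo (-1 : ℝ) 1 := by
  have hx1 := one_sub_sq_pos_of_mem_window h1 hx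
  have := one_sub_sq_cos_half_momentum h0 h1 hx
  have h : 0 < (1 + Real.cos θ - 2 * x ^ 2) / ((1 + Real.cos θ) * (1 - x ^ 2)) :=
    div_pos (by linarith [two_mul_sq_lt_of_mem_window hx]) (mul_pos (by linarith) hx1)
  exact abs_lt.mp ((sq_lt_one_iff_abs_lt_one _).mp (by linarith))

lemma cos_half_momentum (h0 : -1 < Real.cos θ) (h1 : Real.cos θ < 1) (hx : x ∈ window θ) :
    Real.cos (momentum θ x / 2) = √(1 - Real.cos θ) / √(1 + Real.cos θ) * (x / √(1 - x ^ 2)) := by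
  have h := cos_half_momentum_mem h0 h1 hx
  rw [momentum, mul_div_cancel_left₀ _ two_ne_zero, Real.cos_arccos h.1.le h.2.le]

lemma momentum_mem (h0 : -1 < Real.cos θ) (h1 : Real.cos θ < 1) (hx : x ∈ window θ) :
    momentum θ x ∈ Ioo 0 (2 * Real.pi) := by
  have h := cos_half_momentum_mem h0 h1 hx
  have h1 := Real.arccos_pos.mpr h.2
  have h2 := Real.arccos_lt_pi.mpr h.1
  constructor <;> unfold momentum <;> linarith

lemma gap_eq_half (θ k : ℝ) :
    gap θ k = (1 - Real.cos θ) + (1 + Real.cos θ) * Real.cos (k / 2) ^ 2 := by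
  have := two_sub_gap θ k
  rw [Real.sin_sq] at this
  linarith

lemma gap_momentum (h0 : -1 < Real.cos θ) (h1 : Real.cos θ < 1) (hx : x ∈ window θ) :
    gap θ (momentum θ x) = (1 - Real.cos θ) / (1 - x ^ 2) := by
  have hx1 := one_sub_sq_pos_of_mem_window h1 hx
  have hc : 1 + Real.cos θ ≠ 0 := by linarith
  have h := one_sub_sq_cos_half_momentum h0 h1 hx
  rw [gap_eq_half, cos_half_momentum h0 h1 hx, ← sub_sub_cancel 1 (_ ^ 2), h]
  field_simp
  ring

lemma speed_momentum (h0 : -1 < Real.cos θ) (h1 : Real.cos θ < 1) (hx : x ∈ window θ) :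
    speed θ (momentum θ x) = x := by
  have hx1 := one_sub_sq_pos_of_mem_window h1 hx
  have e1 := (Real.sqrt_pos.mpr hx1).ne'
  have e2 := (Real.sqrt_pos.mpr (by linarith : 0 < 1 + Real.cos θ)).ne'
  have e3 := (Real.sqrt_pos.mpr (by linarith : 0 < 1 - Real.cos θ)).ne'
  rw [speed, cos_half_momentum h0 h1 hx, gap_momentum h0 h1 hx, Real.sqrt_div (by linarith)]
  field_simp

lemma one_sub_speed_sq (h0 : -1 < Real.cos θ) (h1 : Real.cos θ < 1) (k : ℝ) :
    1 - speed θ k ^ 2 = (1 - Real.cos θ) / gap θ k := by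
  have hg := gap_pos h1 k
  rw [speed, div_pow, mul_pow, Real.sq_sqrt hg.le, Real.sq_sqrt (by linarith)]
  field_simp
  rw [gap_eq_half]
  ring

lemma speed_mem_window (h0 : -1 < Real.cos θ) (h1 : Real.cos θ < 1)
    (hk : k ∈ Ioo 0 (2 * Real.pi)) : speed θ k ∈ window θ := by
  have hg := gap_pos h1 k
  have hg2 := gap_lt_two h0 hk
  refine abs_lt.mp ((Real.lt_sqrt (abs_nonneg _)).mpr ?_)
  have h := one_sub_speed_sq h0 h1 k
  have : (1 - Real.cos θ) / 2 < (1 - Real.cos θ) / gap θ k :=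
    div_lt_div_of_pos_left (by linarith) hg hg2
  rw [sq_abs]
  linarith

lemma momentum_speed (h0 : -1 < Real.cos θ) (h1 : Real.cos θ < 1)
    (hk : k ∈ Ioo 0 (2 * Real.pi)) : momentum θ (speed θ k) = k := by
  have hg := Real.sqrt_pos.mpr (gap_pos h1 k)
  have e2 := (Real.sqrt_pos.mpr (by linarith : 0 < 1 + Real.cos θ)).ne'
  have e3 := (Real.sqrt_pos.mpr (by linarith : 0 < 1 - Real.cos θ)).ne'
  have h : √(1 - Real.cos θ) / √(1 + Real.cos θ) * (speed θ k / √(1 - speed θ k ^ 2)) =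
      Real.cos (k / 2) := by
    rw [one_sub_speed_sq h0 h1, Real.sqrt_div (by linarith), speed]
    field_simp
  rw [momentum, h, Real.arccos_cos (by linarith [hk.1]) (by linarith [hk.2])]
  ring

lemma image_momentum (h0 : -1 < Real.cos θ) (h1 : Real.cos θ < 1) :
    momentum θ '' window θ = Ioo 0 (2 * Real.pi) := by
  ext k
  constructor
  · rintro ⟨x, hx, rfl⟩
    exact momentum_mem h0 h1 hx
  · exact fun hk => ⟨speed θ k, speed_mem_window h0 h1 hk, momentum_speed h0 h1 hk⟩

lemma injOn_momentum (h0 : -1 < Real.cos θ) (h1 : Real.cos θ < 1) :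
    InjOn (momentum θ) (window θ) := fun x hx y hy h => by
  rw [← speed_momentum h0 h1 hx, h, speed_momentum h0 h1 hy]

/-- The derivative of `momentum θ`, up to its sign. -/
def jacobian (θ x : ℝ) : ℝ :=
  2 * √(1 - Real.cos θ) / ((1 - x ^ 2) * √(1 + Real.cos θ - 2 * x ^ 2))

lemma jacobian_pos (h1 : Real.cos θ < 1) (hx : x ∈ window θ) : 0 < jacobian θ x := by
  have hx1 := one_sub_sq_pos_of_mem_window h1 hx
  have hx2 := two_mul_sq_lt_of_mem_window hx
  have := Real.sqrt_pos.mpr (by linarith : 0 < 1 + Real.cos θ - 2 * x ^ 2)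
  have := Real.sqrt_pos.mpr (by linarith : 0 < 1 - Real.cos θ)
  unfold jacobian
  positivity

lemma hasDerivAt_momentum (h0 : -1 < Real.cos θ) (h1 : Real.cos θ < 1) (hx : x ∈ window θ) :
    HasDerivAt (momentum θ) (-jacobian θ x) x := by
  have hx1 := one_sub_sq_pos_of_mem_window h1 hx
  have hx2 := two_mul_sq_lt_of_mem_window hx
  have hm := cos_half_momentum_mem h0 h1 hx
  have e1 := Real.sqrt_pos.mpr hx1
  have e2 := Real.sqrt_pos.mpr (by linarith : 0 < 1 + Real.cos θ)
  have e3 := Real.sqrt_pos.mpr (by linarith : 0 < 1 - Real.cos θ)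
  have e4 := Real.sqrt_pos.mpr (by linarith : 0 < 1 + Real.cos θ - 2 * x ^ 2)
  have q1 := Real.sq_sqrt hx1.le
  have hs : HasDerivAt (fun x : ℝ => √(1 - x ^ 2)) (-x / √(1 - x ^ 2)) x := by
    have := (((hasDerivAt_id x).pow 2).const_sub 1).sqrt hx1.ne'
    refine this.congr_deriv ?_
    simp
    field_simp
  have hq : HasDerivAt (fun x : ℝ => x / √(1 - x ^ 2)) (1 / ((1 - x ^ 2) * √(1 - x ^ 2))) x := by
    refine ((hasDerivAt_id x).div hs e1.ne').congr_deriv ?_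
    simp only [id]
    rw [q1]
    field_simp
    rw [q1]
    ring
  have := ((Real.hasDerivAt_arccos hm.1.ne' hm.2.ne).comp x
    (hq.const_mul (√(1 - Real.cos θ) / √(1 + Real.cos θ)))).const_mul 2
  refine this.congr_deriv ?_
  rw [one_sub_sq_cos_half_momentum h0 h1 hx, Real.sqrt_div (by linarith),
    Real.sqrt_mul (by linarith), jacobian]
  field_simp

/-- The integral over the momenta, in terms of the group velocity. -/
lemma setIntegral_eq_setIntegral_window (h0 : -1 < Real.cos θ) (h1 : Real.cos θ < 1) (g : ℝ → ℂ) :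
    ∫ k in Ioo 0 (2 * Real.pi), g k = ∫ x in window θ, jacobian θ x * g (momentum θ x) := by
  have hm : MeasurableSet (window θ) := measurableSet_Ioo
  rw [← image_momentum h0 h1, integral_image_eq_integral_abs_deriv_smul hm
    (fun x hx => (hasDerivAt_momentum h0 h1 hx).hasDerivWithinAt) (injOn_momentum h0 h1)]
  refine setIntegral_congr_fun hm fun x hx => ?_
  simp only [abs_neg, abs_of_pos (jacobian_pos h1 hx), Complex.real_smul]

/-! ### The density -/

lemma gap_two_pi_sub (θ k : ℝ) : gap θ (2 * Real.pi - k) = gap θ k := by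
  rw [gap, gap, Real.cos_two_pi_sub]

lemma phase_two_pi_sub (θ k : ℝ) : phase θ (2 * Real.pi - k) = phase θ k := by
  rw [phase, phase, gap_two_pi_sub]

lemma speed_two_pi_sub (θ k : ℝ) : speed θ (2 * Real.pi - k) = -speed θ k := by
  rw [speed, speed, gap_two_pi_sub, show (2 * Real.pi - k) / 2 = Real.pi - k / 2 by ring,
    Real.cos_pi_sub]
  ring

lemma two_pi_sub_mem (hk : k ∈ Ioo 0 (2 * Real.pi)) :
    2 * Real.pi - k ∈ Ioo 0 (2 * Real.pi) := ⟨by linarith [hk.2], by linarith [hk.1]⟩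

/-- The quadratic form of the evolution operator at the initial state. -/
def evoForm (θ : ℝ) (α β γ : ℂ) (k : ℝ) : ℂ := star ![α, β, γ] ⬝ᵥ (evo θ k *ᵥ ![α, β, γ])

lemma star_evoForm (θ : ℝ) (α β γ : ℂ) (k : ℝ) :
    star ![α, β, γ] ⬝ᵥ ((evo θ k)ᴴ *ᵥ ![α, β, γ]) = star (evoForm θ α β γ k) := by
  rw [evoForm, Matrix.star_dotProduct, Matrix.star_mulVec, Matrix.conjTranspose_conjTranspose,
    Matrix.dotProduct_mulVec]

lemma weight_one_two (h0 : -1 < Real.cos θ) (h1 : Real.cos θ < 1) (hk : k ∈ Ioo 0 (2 * Real.pi))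
    (hnorm : ‖α‖ ^ 2 + ‖β‖ ^ 2 + ‖γ‖ ^ 2 = 1) :
    weight θ α β γ k 1 = ((1 - (evoForm θ α β γ k).re) / gap θ k +
      (evoForm θ α β γ k).im / Real.sin (phase θ k)) / 2 ∧
    weight θ α β γ k 2 = ((1 - (evoForm θ α β γ k).re) / gap θ k -
      (evoForm θ α β γ k).im / Real.sin (phase θ k)) / 2 := by
  have hg : (gap θ k : ℂ) ≠ 0 := by exact_mod_cast (gap_pos h1 k).ne'
  have hS : (Real.sin (phase θ k) : ℂ) ≠ 0 := by exact_mod_cast (sin_phase_pos h0 h1 hk).ne'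
  have hv : star ![α, β, γ] ⬝ᵥ ![α, β, γ] = 1 := by
    rw [star_dotProduct_self]
    norm_cast
    simpa [Fin.sum_univ_three] using hnorm
  have e1 : evoForm θ α β γ k + star (evoForm θ α β γ k) = 2 * (evoForm θ α β γ k).re := by
    rw [RCLike.star_def, Complex.add_conj]; push_cast; rfl
  have e2 : evoForm θ α β γ k - star (evoForm θ α β γ k) = 2 * (evoForm θ α β γ k).im * I := by
    rw [RCLike.star_def, Complex.sub_conj]; push_cast; rfl
  have hP : star ![α, β, γ] ⬝ᵥ (flatProj θ k *ᵥ ![α, β, γ]) =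
      (2 * gap θ k : ℂ)⁻¹ * (2 * (evoForm θ α β γ k).re - 2 * (1 - gap θ k)) := by
    rw [flatProj, Matrix.smul_mulVec, dotProduct_smul, Matrix.sub_mulVec, Matrix.add_mulVec,
      dotProduct_sub, dotProduct_add, star_evoForm, ← evoForm, e1, Matrix.smul_mulVec,
      Matrix.one_mulVec, dotProduct_smul, hv, smul_eq_mul, smul_eq_mul, mul_one]
  have hD : star ![α, β, γ] ⬝ᵥ (splitting θ k *ᵥ ![α, β, γ]) =
      (2 * I * Real.sin (phase θ k))⁻¹ * (2 * (evoForm θ α β γ k).im * I) := by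
    rw [splitting, Matrix.smul_mulVec, dotProduct_smul, Matrix.sub_mulVec,
      dotProduct_sub, star_evoForm, ← evoForm, e2, smul_eq_mul]
  have hI := I_ne_zero
  constructor <;> apply Complex.ofReal_injective <;> rw [weight_eq h0 h1 hk]
  · simp only [proj, Matrix.cons_val, Matrix.smul_mulVec, Matrix.add_mulVec, Matrix.sub_mulVec,
      dotProduct_smul, dotProduct_add, dotProduct_sub, Matrix.one_mulVec, hv, hP, hD, smul_eq_mul]
    push_cast [-ofReal_sin]
    field_simp
    ring
  · simp only [proj, Matrix.cons_val, Matrix.smul_mulVec, Matrix.sub_mulVec,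
      dotProduct_smul, dotProduct_sub, Matrix.one_mulVec, hv, hP, hD, smul_eq_mul]
    push_cast [-ofReal_sin]
    field_simp
    ring

lemma sin_div_sin_phase (h0 : -1 < Real.cos θ) (h1 : Real.cos θ < 1)
    (hk : k ∈ Ioo 0 (2 * Real.pi)) :
    Real.sin k / Real.sin (phase θ k) = 2 * speed θ k / (1 + Real.cos θ) := by
  have hsin : Real.sin k = 2 * Real.sin (k / 2) * Real.cos (k / 2) := by
    rw [← Real.sin_two_mul, mul_div_cancel₀ _ two_ne_zero]
  have hc : 0 < 1 + Real.cos θ := by linarith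
  have h2 := Real.sq_sqrt hc.le
  have h3 := (Real.sqrt_pos.mpr hc).ne'
  have h4 := (Real.sqrt_pos.mpr (gap_pos h1 k)).ne'
  have h5 := (sin_half_pos hk).ne'
  rw [sin_phase_eq h1 hk, hsin, speed]
  field_simp
  rw [h2]

/-- The two eigenvalues with the group velocity `x`, one at each of the momenta `k` and `2π - k`,
together have a weight that is a quadratic polynomial in `x`. -/
lemma weight_add_weight (h0 : -1 < Real.cos θ) (h1 : Real.cos θ < 1) (hx : x ∈ window θ)
    (hnorm : ‖α‖ ^ 2 + ‖β‖ ^ 2 + ‖γ‖ ^ 2 = 1) :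
    weight θ α β γ (momentum θ x) 1 + weight θ α β γ (2 * Real.pi - momentum θ x) 2 =
      (d0 α β γ + d1 θ α β γ * x + d2 θ α β γ * x ^ 2) / 2 := by
  have hk := momentum_mem h0 h1 hx
  have hx1 := one_sub_sq_pos_of_mem_window h1 hx
  have hg := gap_momentum h0 h1 hx
  have hs := sin_div_sin_phase h0 h1 hk
  rw [speed_momentum h0 h1 hx] at hs
  have hcos : Real.cos (momentum θ x) =
      (gap θ (momentum θ x) - (3 - Real.cos θ) / 2) * 2 / (1 + Real.cos θ) := by
    have : 1 + Real.cos θ ≠ 0 := by linarith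
    rw [gap]
    field_simp
    ring
  have hform : ∀ k, evoForm θ α β γ k = cexp (k * I) * (star α * (coin θ *ᵥ ![α, β, γ]) 0) +
      star β * (coin θ *ᵥ ![α, β, γ]) 1 +
      cexp (-(k * I)) * (star γ * (coin θ *ᵥ ![α, β, γ]) 2) := fun k => by
    rw [evoForm, evo, ← Matrix.mulVec_mulVec]
    simp only [dotProduct, Fin.sum_univ_three, Matrix.mulVec_diagonal]
    simp
    ring
  have hexp : ∀ k : ℝ, cexp (k * I) = Real.cos k + Real.sin k * I ∧
      cexp (-(k * I)) = Real.cos k - Real.sin k * I := fun k => by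
    rw [Complex.exp_mul_I, ← neg_mul, Complex.exp_mul_I]
    simp
    ring
  rw [(weight_one_two h0 h1 hk hnorm).1, (weight_one_two h0 h1 (two_pi_sub_mem hk) hnorm).2,
    gap_two_pi_sub, phase_two_pi_sub]
  have hre : (evoForm θ α β γ (momentum θ x)).re + (evoForm θ α β γ (2 * Real.pi - momentum θ x)).re
      = 2 * (Real.cos (momentum θ x) * ((star α * (coin θ *ᵥ ![α, β, γ]) 0).re +
        (star γ * (coin θ *ᵥ ![α, β, γ]) 2).re) + (star β * (coin θ *ᵥ ![α, β, γ]) 1).re) := by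
    rw [hform, hform, (hexp _).1, (hexp _).2, (hexp _).1, (hexp _).2, Real.cos_two_pi_sub,
      Real.sin_two_pi_sub]
    simp only [Complex.add_re, Complex.sub_re, Complex.mul_re (_ + _), Complex.mul_re (_ - _),
      Complex.mul_I_re, Complex.mul_I_im,
      Complex.ofReal_re, Complex.ofReal_im, Complex.add_im, Complex.sub_im]
    ring
  have him : (evoForm θ α β γ (momentum θ x)).im - (evoForm θ α β γ (2 * Real.pi - momentum θ x)).im
      = 2 * Real.sin (momentum θ x) * ((star α * (coin θ *ᵥ ![α, β, γ]) 0).re -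
        (star γ * (coin θ *ᵥ ![α, β, γ]) 2).re) := by
    rw [hform, hform, (hexp _).1, (hexp _).2, (hexp _).1, (hexp _).2, Real.cos_two_pi_sub,
      Real.sin_two_pi_sub]
    simp only [Complex.add_im, Complex.sub_im, Complex.mul_im (_ + _), Complex.mul_im (_ - _),
      Complex.mul_I_re, Complex.mul_I_im,
      Complex.ofReal_re, Complex.ofReal_im, Complex.add_re, Complex.sub_re]
    ring
  have hsum : ∀ a b a' b' g S : ℝ, ((1 - a) / g + b / S) / 2 + ((1 - a') / g - b' / S) / 2 =
      ((2 - (a + a')) / g + (b - b') / S) / 2 := fun a b a' b' g S => by ring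
  rw [hsum, hre, him, mul_assoc, mul_div_assoc, mul_div_right_comm (Real.sin _), hs, hcos, hg]
  obtain ⟨σ, c, h, hc, hσ, hC⟩ := coin_eq θ
  have e : √2 * Real.sin θ = 2 * σ := by
    rw [hσ]
    have := Real.sq_sqrt (show (0 : ℝ) ≤ 2 by norm_num)
    field_simp
    linear_combination Real.sin θ * this
  have hc1 : 1 - c ≠ 0 := by rw [hc]; linarith
  have hc2 : 1 + c ≠ 0 := by rw [hc]; linarith
  rw [d0, d1, d2, hC, e, ← hc]
  simp only [Complex.sq_norm, Complex.normSq_apply] at hnorm ⊢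
  simp [Matrix.mulVec, dotProduct, Fin.sum_univ_three]
  -- The `1` in the weights of both bands is the squared norm of the initial state.
  linear_combination (norm := skip) (-2 * (1 - x ^ 2) / (1 - c)) * hnorm
  field_simp
  ring

/-- The weight carried by the group velocity `speed θ k`. -/
def speedWeight (θ : ℝ) (α β γ : ℂ) (k : ℝ) : ℝ :=
  weight θ α β γ k 1 + weight θ α β γ (2 * Real.pi - k) 2

lemma density_eq (h0 : -1 < Real.cos θ) (h1 : Real.cos θ < 1) (hx : x ∈ window θ)
    (hnorm : ‖α‖ ^ 2 + ‖β‖ ^ 2 + ‖γ‖ ^ 2 = 1) :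
    density θ α β γ x = (2 * Real.pi)⁻¹ *
      (jacobian θ x * speedWeight θ α β γ (momentum θ x)) := by
  have e1 := (one_sub_sq_pos_of_mem_window h1 hx).ne'
  have e2 := (Real.sqrt_pos.mpr (sub_pos.mpr (two_mul_sq_lt_of_mem_window hx))).ne'
  rw [speedWeight, weight_add_weight h0 h1 hx hnorm, density, jacobian]
  field_simp

lemma density_nonneg (h0 : -1 < Real.cos θ) (h1 : Real.cos θ < 1) (hx : x ∈ window θ)
    (hnorm : ‖α‖ ^ 2 + ‖β‖ ^ 2 + ‖γ‖ ^ 2 = 1) : 0 ≤ density θ α β γ x := by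
  rw [density_eq h0 h1 hx hnorm]
  have := Real.pi_pos
  exact mul_nonneg (by positivity) (mul_nonneg (jacobian_pos h1 hx).le
    (add_nonneg (weight_nonneg ..) (weight_nonneg ..)))

lemma integrableOn_weight (h0 : -1 < Real.cos θ) (h1 : Real.cos θ < 1)
    (hnorm : ‖α‖ ^ 2 + ‖β‖ ^ 2 + ‖γ‖ ^ 2 = 1) (j : Fin 3) :
    IntegrableOn (fun k => weight θ α β γ k j) (Ioo 0 (2 * Real.pi)) := by
  refine IntegrableOn.of_bound measure_Ioo_lt_top
    ((continuousOn_weight h0 h1 j).aestronglyMeasurable measurableSet_Ioo) 1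
    ((ae_restrict_iff' measurableSet_Ioo).mpr (ae_of_all _ fun k hk => ?_))
  rw [Real.norm_of_nonneg (weight_nonneg ..)]
  exact weight_le_one h0 h1 hk hnorm j

lemma measurePreserving_two_pi_sub : MeasurePreserving (fun k : ℝ => 2 * Real.pi - k)
    (volume.restrict (Ioo 0 (2 * Real.pi))) (volume.restrict (Ioo 0 (2 * Real.pi))) := by
  have h := (Measure.measurePreserving_sub_left (volume : Measure ℝ) (2 * Real.pi)).restrict_preimage
    (measurableSet_Ioo (a := 0) (b := 2 * Real.pi))
  simpa using h

lemma measurableEmbedding_two_pi_sub : MeasurableEmbedding fun k : ℝ => 2 * Real.pi - k :=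
  (Homeomorph.subLeft (2 * Real.pi)).measurableEmbedding

lemma integrableOn_speedWeight (h0 : -1 < Real.cos θ) (h1 : Real.cos θ < 1)
    (hnorm : ‖α‖ ^ 2 + ‖β‖ ^ 2 + ‖γ‖ ^ 2 = 1) :
    IntegrableOn (speedWeight θ α β γ) (Ioo 0 (2 * Real.pi)) :=
  (integrableOn_weight h0 h1 hnorm 1).add
    (measurePreserving_two_pi_sub.integrable_comp_of_integrable (integrableOn_weight h0 h1 hnorm 2))

lemma integrableOn_density (h0 : -1 < Real.cos θ) (h1 : Real.cos θ < 1)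
    (hnorm : ‖α‖ ^ 2 + ‖β‖ ^ 2 + ‖γ‖ ^ 2 = 1) :
    IntegrableOn (density θ α β γ) (window θ) := by
  have hm : MeasurableSet (window θ) := measurableSet_Ioo
  have h := integrableOn_speedWeight h0 h1 hnorm
  rw [← image_momentum h0 h1, integrableOn_image_iff_integrableOn_abs_deriv_smul hm
    (fun x hx => (hasDerivAt_momentum h0 h1 hx).hasDerivWithinAt) (injOn_momentum h0 h1)] at h
  refine IntegrableOn.congr_fun (h.const_mul (2 * Real.pi)⁻¹) (fun x hx => ?_) hm
  simp only [density_eq h0 h1 hx hnorm, abs_neg, abs_of_pos (jacobian_pos h1 hx), smul_eq_mul]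

lemma integrableOn_cexp_mul (h1 : Real.cos θ < 1) {ω ξ : ℝ} {g : ℝ → ℝ}
    (hg : IntegrableOn g (Ioo 0 (2 * Real.pi))) :
    IntegrableOn (fun k => cexp (ω * (ξ * speed θ k) * I) * g k) (Ioo 0 (2 * Real.pi)) := by
  refine Integrable.bdd_mul (c := 1) hg.ofReal ?_ (ae_of_all _ fun k => ?_)
  · refine Continuous.aestronglyMeasurable ?_
    have hs : Continuous (speed θ) :=
      (continuous_const.mul (by fun_prop)).div (continuous_gap θ).sqrt
        fun k => (Real.sqrt_pos.mpr (gap_pos h1 k)).ne'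
    fun_prop
  · have := Complex.norm_exp_ofReal_mul_I (ω * (ξ * speed θ k))
    push_cast at this
    exact this.le

/-- The limit of the characteristic functions, in terms of the atom and the density. -/
lemma setIntegral_sum_weight (h0 : -1 < Real.cos θ) (h1 : Real.cos θ < 1)
    (hnorm : ‖α‖ ^ 2 + ‖β‖ ^ 2 + ‖γ‖ ^ 2 = 1) (ξ : ℝ) :
    (2 * Real.pi : ℂ)⁻¹ * ∫ k in Ioo (0 : ℝ) (2 * Real.pi),
      ∑ j, cexp (freq j * (ξ * speed θ k) * I) * weight θ α β γ k j =
    Delta θ α β γ + ∫ x in window θ, cexp (ξ * x * I) * density θ α β γ x := by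
  have hpi : (2 * Real.pi : ℂ) ≠ 0 := by exact_mod_cast (by positivity : 2 * Real.pi ≠ 0)
  have hw := fun j => integrableOn_weight h0 h1 hnorm (θ := θ) j
  rw [integral_finsetSum _ fun j _ => integrableOn_cexp_mul h1 (hw j), Fin.sum_univ_three]
  have e0 : ∫ k in Ioo (0 : ℝ) (2 * Real.pi), cexp (freq 0 * (ξ * speed θ k) * I) *
      weight θ α β γ k 0 = 2 * Real.pi * Delta θ α β γ := by
    rw [← setIntegral_weight_zero h0 h1 hnorm]
    simp [freq]
  have e2 : ∫ k in Ioo (0 : ℝ) (2 * Real.pi), cexp (freq 2 * (ξ * speed θ k) * I) *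
      weight θ α β γ k 2 = ∫ k in Ioo (0 : ℝ) (2 * Real.pi),
        cexp (freq 1 * (ξ * speed θ k) * I) * weight θ α β γ (2 * Real.pi - k) 2 := by
    rw [← measurePreserving_two_pi_sub.integral_comp measurableEmbedding_two_pi_sub]
    simp [speed_two_pi_sub, freq]
  have hr := measurePreserving_two_pi_sub.integrable_comp_of_integrable (hw 2)
  have e3 : (∫ k in Ioo (0 : ℝ) (2 * Real.pi), cexp (freq 1 * (ξ * speed θ k) * I) *
      weight θ α β γ k 1) + ∫ k in Ioo (0 : ℝ) (2 * Real.pi),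
        cexp (freq 1 * (ξ * speed θ k) * I) * weight θ α β γ (2 * Real.pi - k) 2 =
      2 * Real.pi * ∫ x in window θ, cexp (ξ * x * I) * density θ α β γ x := by
    refine (integral_add (integrableOn_cexp_mul h1 (hw 1))
      (integrableOn_cexp_mul h1 hr)).symm.trans ?_
    rw [setIntegral_eq_setIntegral_window h0 h1, ← integral_const_mul]
    refine setIntegral_congr_fun measurableSet_Ioo fun x hx => ?_
    simp only [speed_momentum h0 h1 hx, density_eq h0 h1 hx hnorm, speedWeight, freq, Function.comp]
    push_cast
    simp
    field_simp
  rw [e0, e2, add_assoc, e3, ← mul_add, inv_mul_cancel_left₀ hpi]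

lemma Delta_nonneg (h0 : -1 < Real.cos θ) (h1 : Real.cos θ < 1) (α β γ : ℂ) :
    0 ≤ Delta θ α β γ :=
  (hasSum_limitMass h0 h1 α β γ).nonneg fun x => by
    rw [← sum_norm_sq_flatAmplitude h1]
    positivity

lemma measurable_density (θ : ℝ) (α β γ : ℂ) : Measurable (density θ α β γ) := by
  unfold density
  fun_prop

/-- The absolutely continuous part of the limit law, as a Bochner integral of the density. -/
lemma lintegral_density (h0 : -1 < Real.cos θ) (h1 : Real.cos θ < 1)
    (hnorm : ‖α‖ ^ 2 + ‖β‖ ^ 2 + ‖γ‖ ^ 2 = 1) {s : Set ℝ} (hs : MeasurableSet s) :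
    (volume.restrict (window θ)).withDensity (fun x => ENNReal.ofReal (density θ α β γ x)) s =
      ENNReal.ofReal (∫ y in s, (window θ).indicator (density θ α β γ) y) := by
  have hm : MeasurableSet (window θ) := measurableSet_Ioo
  rw [withDensity_apply _ hs, Measure.restrict_restrict hs, setIntegral_indicator hm,
    ofReal_integral_eq_lintegral_ofReal]
  · exact (integrableOn_density h0 h1 hnorm).mono_set inter_subset_right
  · exact (ae_restrict_iff' (hs.inter hm)).mpr
      (ae_of_all _ fun x hx => density_nonneg h0 h1 hx.2 hnorm)

lemma Delta_add_integral_density (h0 : -1 < Real.cos θ) (h1 : Real.cos θ < 1)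
    (hnorm : ‖α‖ ^ 2 + ‖β‖ ^ 2 + ‖γ‖ ^ 2 = 1) :
    Delta θ α β γ + ∫ x in window θ, density θ α β γ x = 1 := by
  have hpi : (2 * Real.pi : ℂ) ≠ 0 := by exact_mod_cast (by positivity : 2 * Real.pi ≠ 0)
  have h := setIntegral_sum_weight h0 h1 hnorm 0
  have e : ∫ k in Ioo (0 : ℝ) (2 * Real.pi),
      ∑ j, cexp (freq j * ((0 : ℝ) * speed θ k) * I) * weight θ α β γ k j = 2 * Real.pi := by
    rw [setIntegral_congr_fun (g := fun _ => (1 : ℂ)) measurableSet_Ioo fun k hk => ?_]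
    · rw [setIntegral_const, Real.volume_real_Ioo_of_le (by positivity)]
      simp
    · simp only [ofReal_zero, zero_mul, mul_zero, Complex.exp_zero, one_mul]
      exact_mod_cast sum_weight h0 h1 hk hnorm
  rw [e, inv_mul_cancel₀ hpi] at h
  simp only [ofReal_zero, zero_mul, Complex.exp_zero, one_mul] at h
  rw [integral_complex_ofReal] at h
  exact_mod_cast h.symm

lemma isProbabilityMeasure_limitLaw (h0 : -1 < Real.cos θ) (h1 : Real.cos θ < 1)
    (hnorm : ‖α‖ ^ 2 + ‖β‖ ^ 2 + ‖γ‖ ^ 2 = 1) : IsProbabilityMeasure (limitLaw θ α β γ) := by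
  have hm : MeasurableSet (window θ) := measurableSet_Ioo
  constructor
  rw [limitLaw, Measure.add_apply, Measure.smul_apply, lintegral_density h0 h1 hnorm .univ,
    measure_univ, smul_eq_mul, mul_one, setIntegral_univ, integral_indicator hm,
    ← ENNReal.ofReal_add (Delta_nonneg h0 h1 α β γ)
      (setIntegral_nonneg hm fun x hx => density_nonneg h0 h1 hx hnorm),
    Delta_add_integral_density h0 h1 hnorm, ENNReal.ofReal_one]

lemma charFun_limitLaw (h0 : -1 < Real.cos θ) (h1 : Real.cos θ < 1)
    (hnorm : ‖α‖ ^ 2 + ‖β‖ ^ 2 + ‖γ‖ ^ 2 = 1) (ξ : ℝ) :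
    charFun (limitLaw θ α β γ) ξ =
      Delta θ α β γ + ∫ x in window θ, cexp (ξ * x * I) * density θ α β γ x := by
  have := isProbabilityMeasure_limitLaw h0 h1 hnorm
  have hm : MeasurableSet (window θ) := measurableSet_Ioo
  have hi : Integrable (fun x : ℝ => cexp (ξ * x * I)) (limitLaw θ α β γ) := by
    refine Integrable.of_bound (Continuous.aestronglyMeasurable (by fun_prop)) 1
      (ae_of_all _ fun x => ?_)
    rw [← ofReal_mul, Complex.norm_exp_ofReal_mul_I]
  rw [charFun_apply_real]
  unfold limitLaw at hi ⊢
  rw [integrable_add_measure] at hi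
  rw [integral_add_measure hi.1 hi.2, integral_smul_measure, integral_dirac,
    ENNReal.toReal_ofReal (Delta_nonneg h0 h1 α β γ),
    integral_withDensity_eq_integral_toReal_smul (measurable_density θ α β γ).ennreal_ofReal
      (ae_of_all _ fun _ => ENNReal.ofReal_lt_top)]
  congr 1
  · simp
  · refine setIntegral_congr_fun hm fun x hx => ?_
    simp only [ENNReal.toReal_ofReal (density_nonneg h0 h1 hx hnorm), Complex.real_smul]
    ring

lemma limitLaw_real_Iic (h0 : -1 < Real.cos θ) (h1 : Real.cos θ < 1)
    (hnorm : ‖α‖ ^ 2 + ‖β‖ ^ 2 + ‖γ‖ ^ 2 = 1) (x : ℝ) :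
    (limitLaw θ α β γ).real (Iic x) = (if 0 ≤ x then Delta θ α β γ else 0) +
      ∫ y in Iic x, (window θ).indicator (density θ α β γ) y := by
  have hn : 0 ≤ ∫ y in Iic x, (window θ).indicator (density θ α β γ) y :=
    integral_nonneg fun y => indicator_nonneg (fun y hy => density_nonneg h0 h1 hy hnorm) y
  have hΔ := Delta_nonneg h0 h1 α β γ
  rw [measureReal_def, limitLaw, Measure.add_apply, Measure.smul_apply,
    lintegral_density h0 h1 hnorm measurableSet_Iic, Measure.dirac_apply' _ measurableSet_Iic]
  split_ifs with hx
  · rw [indicator_of_mem (by exact hx), Pi.one_apply, smul_eq_mul, mul_one,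
      ← ENNReal.ofReal_add hΔ hn, ENNReal.toReal_ofReal (add_nonneg hΔ hn)]
  · rw [indicator_of_notMem (by exact hx), smul_zero, zero_add, zero_add, ENNReal.toReal_ofReal hn]

lemma limitLaw_singleton (hx : x ≠ 0 ∨ Delta θ α β γ = 0) : limitLaw θ α β γ {x} = 0 := by
  rw [limitLaw, Measure.add_apply, Measure.smul_apply, add_eq_zero]
  refine ⟨?_, withDensity_absolutelyContinuous _ _ (by simp)⟩
  rcases hx with hx | hx
  · rw [Measure.dirac_apply' _ (measurableSet_singleton x), indicator_of_notMem (by simpa using hx.symm),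
      smul_zero]
  · simp [hx]

end

end ThreeStateWalk

theorem theorem2 (θ : ℝ) (hθ : θ ∈ Ico 0 (2 * Real.pi)) (hθ0 : θ ≠ 0) (hθπ : θ ≠ Real.pi)
    (α β γ : ℂ) (hnorm : ‖α‖ ^ 2 + ‖β‖ ^ 2 + ‖γ‖ ^ 2 = 1) :
    -- the weight and the density are genuine (non-negative, integrable)
    0 ≤ Delta θ α β γ ∧
    (∀ x ∈ window θ, 0 ≤ density θ α β γ x) ∧
    IntegrableOn (density θ α β γ) (window θ) ∧
    -- `X_t / t` converges in distribution to the limit law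
    (∃ (_ : ∀ t, IsProbabilityMeasure (law θ α β γ t))
        (_ : IsProbabilityMeasure (limitLaw θ α β γ)),
      TendstoInDistribution (fun (t : ℕ) (n : ℤ) => (n : ℝ) / (t : ℝ)) atTop (fun y : ℝ => y)
        (fun t => law θ α β γ t) (limitLaw θ α β γ)) ∧
    -- the distribution functions converge at every continuity point of the limit
    (∀ x : ℝ, x ≠ 0 ∨ Delta θ α β γ = 0 →
      Tendsto (fun t : ℕ => (law θ α β γ t).real {n : ℤ | (n : ℝ) / (t : ℝ) ≤ x}) atTop
        (𝓝 ((if 0 ≤ x then Delta θ α β γ else 0)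
          + ∫ y in Iic x, (window θ).indicator (density θ α β γ) y))) ∧
    -- the unscaled walk has a limit measure, whose total mass is the weight of the atom
    (∀ x : ℤ, Tendsto (fun t : ℕ => prob θ α β γ t x) atTop (𝓝 (limitMass θ α β γ x))) ∧
    HasSum (limitMass θ α β γ) (Delta θ α β γ) := by
  have h1 : Real.cos θ < 1 := cos_lt_one_of_mem ⟨lt_of_le_of_ne hθ.1 hθ0.symm, hθ.2⟩
  have h0 : -1 < Real.cos θ := by
    have h : Real.cos (θ - Real.pi) = 1 → θ - Real.pi = 0 :=
      (Real.cos_eq_one_iff_of_lt_of_lt (by linarith [hθ.1, Real.pi_pos]) (by linarith [hθ.2, Real.pi_pos])).mp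
    rw [Real.cos_sub_pi] at h
    refine lt_of_le_of_ne (Real.neg_one_le_cos θ) fun h' => hθπ ?_
    exact sub_eq_zero.mp (h (by rw [← h', neg_neg]))
  have hlaw : ∀ t, IsProbabilityMeasure (law θ α β γ t) := fun t => isProbabilityMeasure_law hnorm t
  have hlim : IsProbabilityMeasure (limitLaw θ α β γ) := isProbabilityMeasure_limitLaw h0 h1 hnorm
  have hmeas : ∀ t : ℕ, Measurable fun n : ℤ => (n : ℝ) / (t : ℝ) :=
    fun t => measurable_of_countable _
  have hD : TendstoInDistribution (fun (t : ℕ) (n : ℤ) => (n : ℝ) / (t : ℝ)) atTop (fun y : ℝ => y)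
      (fun t => law θ α β γ t) (limitLaw θ α β γ) := by
    refine ⟨fun t => (hmeas t).aemeasurable, by fun_prop, ?_⟩
    refine ProbabilityMeasure.tendsto_of_tendsto_charFun fun ξ => ?_
    have h := tendsto_charFun h0 h1 hnorm ξ
    rw [setIntegral_sum_weight h0 h1 hnorm, ← charFun_limitLaw h0 h1 hnorm] at h
    simpa using h
  refine ⟨Delta_nonneg h0 h1 α β γ, fun x hx => density_nonneg h0 h1 hx hnorm,
    integrableOn_density h0 h1 hnorm, ⟨hlaw, hlim, hD⟩, fun x hx => ?_,
    fun x => tendsto_prob h0 h1 hnorm x, hasSum_limitMass h0 h1 α β γ⟩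
  have hfr : (limitLaw θ α β γ).map (fun y : ℝ => y) (frontier (Iic x)) = 0 := by
    rw [Measure.map_id', frontier_Iic]
    exact limitLaw_singleton hx
  have h := ProbabilityMeasure.tendsto_measure_of_null_frontier_of_tendsto' hD.tendsto hfr
  rw [← limitLaw_real_Iic h0 h1 hnorm]
  simp only [ProbabilityMeasure.coe_mk, Measure.map_id'] at h
  refine ((ENNReal.tendsto_toReal (measure_ne_top _ _)).comp h).congr fun t => ?_
  rw [Function.comp, Measure.map_apply (hmeas t) measurableSet_Iic]
  rfl
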